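/- Let $d\ge 1$ be an integer and let $\mathcal W$ be the complex Weyl algebra, i.e. the unital associative $\mathbb C$-algebra (with unit $I$) generated by $a_1,\dots,a_d,a_1^+,\dots,a_d^+$ subject to $a_ja_k^+-a_k^+a_j=\delta_{jk}I$, $a_ja_k=a_ka_j$, $a_j^+a_k^+=a_k^+a_j^+$. Let $N=\sum_{j=1}^d a_j^+a_j$. For real $q$ let $M_j w=(1-q)\,a_jw+q\,wa_j$ and $M_j^+w=q\,a_j^+w+(1-q)\,wa_j^+$ for $w\in\mathcal W$; these $2d$ endomorphisms of $\mathcal W$ commute. Let $\mathcal O_q:\mathbb C[z_1,\dots,z_d,\bar z_1,\dots,\bar z_d]\to\mathcal W$ be the ($q$-ordering) linear isomorphism with $\mathcal O_q(z^\alpha\bar z^\beta)=M_1^{\alpha_1}\cdots M_d^{\alpha_d}(M_1^+)^{\beta_1}\cdots(M_d^+)^{\beta_d}I$, and let $\mathcal R_q$ be the endomorphism of $\mathcal W$ with $\mathcal O_q(r^2p)=\mathcal R_q\mathcal O_q(p)$ for all $p$, where $r^2=\sum_j z_j\bar z_j$. For each integer $k\ge0$ there is a unique polynomial $\omega_k=\omega_k(q,d;\cdot)\in\mathbb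 C[t]$ with $\mathcal R_q^kI=\omega_k(N)$. For $0<q<1$ put $\alpha=(q(1-q))^{-1/2}$ and $$g_k(q,d;\lambda)=\frac{i^k\alpha^k}{k!}\,\omega_k(t),\qquad \lambda=i\alpha\,(t+(1-q)d).$$ Write $(x)_k=x(x+1)\cdots(x+k-1)$, and define the continuous Hahn and Meixner–Pollaczek polynomials by $$p_k(x;a,b,c,e)=i^k\frac{(a+c)_k(a+e)_k}{k!}\;{}_3F_2(-k,\,k+a+b+c+e-1,\,a+ix;\;a+c,\,a+e;\;1),$$ $$P_k^{(a)}(x;\phi)=e^{ik\phi}\,{}_2F_1(-k,\,a+ix;\;2a;\;1-e^{-2i\phi}).$$ **Theorem 3.** For $q=\tfrac12$ and every integer $d\ge1$, the polynomials $g_k(\lambda)=g_k(\tfrac12,d;\lambda)$ satisfy, for all integers $k\ge0$ and all $\lambda\in\mathbb C$, $$g_k(\lambda)=\frac{(d)_k}{(\frac d2)_k(\frac d2+\frac12)_k}\;p_k\!\left(\frac\lambda4;\frac d4,\frac d4+\frac12,\frac d4,\frac d4+\frac12\right) \qquad\text{and}\qquad g_k(\lambda)=\frac{(d)_k}{k!}\,P_k^{(d/2)}\!\left(\frac\lambda2;\frac\pi2\right).$$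 Moreover, they are orthogonal on $(-\infty,\infty)$ with respect to the measure $\rho(\lambda)\,d\lambda$, $\rho(\lambda)=\left|\Gamma\!\left(\frac d2+i\frac\lambda2\right)\right|^2$: for all $m,n\ge0$ the function $g_m\overline{g_n}\,\rho$ is integrable on $\mathbb R$, $\int_{\mathbb R}g_m(\lambda)\overline{g_n(\lambda)}\rho(\lambda)\,d\lambda=0$ if $m\ne n$, and $\int_{\mathbb R}|g_n(\lambda)|^2\rho(\lambda)\,d\lambda>0$. -/

import Mathlib

namespace WeylRadial

/-- The canonical commutation relations; `Sum.inl j` indexes the generator `a_j`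
and `Sum.inr j` the generator `a_j⁺`. -/
inductive CCR (d : ℕ) :
    FreeAlgebra ℂ (Fin d ⊕ Fin d) → FreeAlgebra ℂ (Fin d ⊕ Fin d) → Prop
  | mixed (j k : Fin d) :
      CCR d (FreeAlgebra.ι ℂ (Sum.inl j) * FreeAlgebra.ι ℂ (Sum.inr k)
          - FreeAlgebra.ι ℂ (Sum.inr k) * FreeAlgebra.ι ℂ (Sum.inl j))
        (if j = k then 1 else 0)
  | lower (j k : Fin d) :
      CCR d (FreeAlgebra.ι ℂ (Sum.inl j) * FreeAlgebra.ι ℂ (Sum.inl k)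
          - FreeAlgebra.ι ℂ (Sum.inl k) * FreeAlgebra.ι ℂ (Sum.inl j)) 0
  | raise (j k : Fin d) :
      CCR d (FreeAlgebra.ι ℂ (Sum.inr j) * FreeAlgebra.ι ℂ (Sum.inr k)
          - FreeAlgebra.ι ℂ (Sum.inr k) * FreeAlgebra.ι ℂ (Sum.inr j)) 0

/-- The (complex) Weyl algebra with `2 d` generators. -/
abbrev Weyl (d : ℕ) : Type := RingQuot (CCR d)

/-- The annihilation generator `a_j`. -/
noncomputable def ann (d : ℕ) (j : Fin d) : Weyl d :=
  RingQuot.mkAlgHom ℂ (CCR d) (FreeAlgebra.ι ℂ (Sum.inl j))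

/-- The creation generator `a_j⁺`. -/
noncomputable def cre (d : ℕ) (j : Fin d) : Weyl d :=
  RingQuot.mkAlgHom ℂ (CCR d) (FreeAlgebra.ι ℂ (Sum.inr j))

/-- The number operator `N = ∑ a_j⁺ a_j`. -/
noncomputable def number (d : ℕ) : Weyl d := ∑ j, cre d j * ann d j

/-- `M_j = (1-q) L_{a_j} + q R_{a_j}`. -/
noncomputable def opM (q : ℝ) (d : ℕ) (j : Fin d) : Module.End ℂ (Weyl d) :=
  (1 - (q : ℂ)) • LinearMap.mulLeft ℂ (ann d j) + (q : ℂ) • LinearMap.mulRight ℂ (ann d j)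

/-- `M_j⁺ = q L_{a_j⁺} + (1-q) R_{a_j⁺}`. -/
noncomputable def opMplus (q : ℝ) (d : ℕ) (j : Fin d) : Module.End ℂ (Weyl d) :=
  (q : ℂ) • LinearMap.mulLeft ℂ (cre d j) + (1 - (q : ℂ)) • LinearMap.mulRight ℂ (cre d j)

/-- The complex polynomial algebra on `ℝ^{2d}`, in the coordinates `z_j` (index `Sum.inl j`)
and `z̄_j` (index `Sum.inr j`). -/
abbrev Poly (d : ℕ) : Type := MvPolynomial (Fin d ⊕ Fin d) ℂ

/-- The `q`-ordering map: the linear map with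
`z^α z̄^β ↦ M_1^{α_1} ⋯ M_d^{α_d} (M_1⁺)^{β_1} ⋯ (M_d⁺)^{β_d} I`. -/
noncomputable def ordering (q : ℝ) (d : ℕ) : Poly d →ₗ[ℂ] Weyl d :=
  (MvPolynomial.basisMonomials (Fin d ⊕ Fin d) ℂ).constr ℂ fun m =>
    ((List.ofFn fun j => opM q d j ^ m (Sum.inl j)).prod *
      (List.ofFn fun j => opMplus q d j ^ m (Sum.inr j)).prod) 1

/-- The square of the radius, `r² = ∑ z_j z̄_j`. -/
noncomputable def radiusSq (d : ℕ) : Poly d :=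
  ∑ j, MvPolynomial.X (Sum.inl j) * MvPolynomial.X (Sum.inr j)

/-! ### The ordering map is bijective -/

theorem ann_cre (d : ℕ) (j k : Fin d) :
    ann d j * cre d k - cre d k * ann d j = if j = k then 1 else 0 := by
  have h := RingQuot.mkAlgHom_rel ℂ (CCR.mixed (d := d) j k)
  simp only [map_sub, map_mul] at h
  rw [ann, cre, h]
  split_ifs <;> simp

theorem ann_ann (d : ℕ) (j k : Fin d) : ann d j * ann d k = ann d k * ann d j := by
  have h := RingQuot.mkAlgHom_rel ℂ (CCR.lower (d := d) j k)
  simp only [map_sub, map_mul, map_zero] at h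
  exact sub_eq_zero.mp h

theorem cre_cre (d : ℕ) (j k : Fin d) : cre d j * cre d k = cre d k * cre d j := by
  have h := RingQuot.mkAlgHom_rel ℂ (CCR.raise (d := d) j k)
  simp only [map_sub, map_mul, map_zero] at h
  exact sub_eq_zero.mp h

theorem ann_cre' (d : ℕ) (j k : Fin d) :
    ann d j * cre d k = cre d k * ann d j + if j = k then 1 else 0 := by
  rw [← ann_cre]; abel

theorem opM_apply (q : ℝ) (d : ℕ) (j : Fin d) (w : Weyl d) :
    opM q d j w = (1 - (q : ℂ)) • (ann d j * w) + (q : ℂ) • (w * ann d j) := rfl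

theorem opMplus_apply (q : ℝ) (d : ℕ) (j : Fin d) (w : Weyl d) :
    opMplus q d j w = (q : ℂ) • (cre d j * w) + (1 - (q : ℂ)) • (w * cre d j) := rfl

/-- The family `M_1, …, M_d, M_1⁺, …, M_d⁺`. -/
noncomputable def opFamily (q : ℝ) (d : ℕ) : Fin d ⊕ Fin d → Module.End ℂ (Weyl d) :=
  Sum.elim (opM q d) (opMplus q d)

theorem opM_opMplus_comm (q : ℝ) (d : ℕ) (j k : Fin d) :
    opM q d j * opMplus q d k = opMplus q d k * opM q d j := by
  ext w
  simp only [Module.End.mul_apply, opM_apply, opMplus_apply, mul_add, add_mul, smul_add,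
    mul_smul_comm, smul_mul_assoc, mul_assoc]
  have h1 : ann d j * (cre d k * w) = cre d k * (ann d j * w) + if j = k then w else 0 := by
    rw [← mul_assoc, ann_cre', add_mul, mul_assoc]; split_ifs <;> simp
  have h2 : w * (ann d j * cre d k) = w * (cre d k * ann d j) + if j = k then w else 0 := by
    rw [ann_cre', mul_add]; split_ifs <;> simp
  rw [h1, h2]
  module

theorem opFamily_comm (q : ℝ) (d : ℕ) (x y : Fin d ⊕ Fin d) :
    opFamily q d x * opFamily q d y = opFamily q d y * opFamily q d x := by
  rcases x with j | j <;> rcases y with k | k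
  · ext w
    simp only [opFamily, Sum.elim_inl, Module.End.mul_apply, opM_apply, mul_add, add_mul,
      smul_add, mul_smul_comm, smul_mul_assoc, mul_assoc]
    rw [← mul_assoc (ann d j) (ann d k) w, ann_ann d j k, mul_assoc]
    module
  · exact opM_opMplus_comm q d j k
  · exact (opM_opMplus_comm q d k j).symm
  · ext w
    simp only [opFamily, Sum.elim_inr, Module.End.mul_apply, opMplus_apply, mul_add, add_mul,
      smul_add, mul_smul_comm, smul_mul_assoc, mul_assoc]
    rw [← mul_assoc (cre d j) (cre d k) w, cre_cre d j k, mul_assoc]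
    module

/-- Polynomials can be evaluated at a commuting family in a noncommutative algebra. -/
theorem exists_aeval_of_comm {σ A : Type} [Ring A] [Algebra ℂ A] (f : σ → A)
    (h : ∀ x y, f x * f y = f y * f x) :
    ∃ F : MvPolynomial σ ℂ →ₐ[ℂ] A, ∀ x, F (MvPolynomial.X x) = f x := by
  have hc : ∀ x ∈ Set.range f, ∀ y ∈ Set.range f, x * y = y * x := by
    rintro _ ⟨x, rfl⟩ _ ⟨y, rfl⟩
    exact h x y
  have := Algebra.isMulCommutative_adjoin ℂ hc
  let _ : CommRing (Algebra.adjoin ℂ (Set.range f)) :=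
    { (inferInstance : Ring (Algebra.adjoin ℂ (Set.range f))) with mul_comm := this.is_comm.comm }
  let e : σ → Algebra.adjoin ℂ (Set.range f) :=
    fun x => ⟨f x, Algebra.subset_adjoin ⟨x, rfl⟩⟩
  refine ⟨(Algebra.adjoin ℂ (Set.range f)).val.comp (MvPolynomial.aeval e), fun x => ?_⟩
  rw [AlgHom.comp_apply, MvPolynomial.aeval_X]
  rfl

/-- There is an algebra map `Poly → End(Weyl)` evaluating at the family, and the ordering map
is this evaluation applied to `I`. -/
theorem exists_evaluation (q : ℝ) (d : ℕ) :
    ∃ F : Poly d →ₐ[ℂ] Module.End ℂ (Weyl d),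
      (∀ x, F (MvPolynomial.X x) = opFamily q d x) ∧ ∀ p, ordering q d p = F p 1 := by
  obtain ⟨F, hX⟩ := exists_aeval_of_comm (opFamily q d) (opFamily_comm q d)
  refine ⟨F, hX, fun p => ?_⟩
  have hlin : ordering q d = (LinearMap.applyₗ (1 : Weyl d)).comp F.toLinearMap := by
    apply (MvPolynomial.basisMonomials (Fin d ⊕ Fin d) ℂ).ext
    intro m
    rw [ordering, Module.Basis.constr_basis, MvPolynomial.coe_basisMonomials,
      LinearMap.comp_apply, AlgHom.toLinearMap_apply, LinearMap.applyₗ_apply_apply]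
    have hm : (MvPolynomial.monomial m (1 : ℂ) : Poly d) =
        (List.ofFn fun j => (MvPolynomial.X (Sum.inl j) : Poly d) ^ m (Sum.inl j)).prod *
        (List.ofFn fun j => (MvPolynomial.X (Sum.inr j) : Poly d) ^ m (Sum.inr j)).prod := by
      rw [MvPolynomial.monomial_eq, List.prod_ofFn, List.prod_ofFn, map_one, one_mul,
        Finsupp.prod_fintype _ _ (fun _ => pow_zero _), Fintype.prod_sum_type]
    have h1 : ∀ j, F ((MvPolynomial.X (Sum.inl j) : Poly d) ^ m (Sum.inl j)) =
        opM q d j ^ m (Sum.inl j) := fun j => by rw [map_pow, hX]; rfl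
    have h2 : ∀ j, F ((MvPolynomial.X (Sum.inr j) : Poly d) ^ m (Sum.inr j)) =
        opMplus q d j ^ m (Sum.inr j) := fun j => by rw [map_pow, hX]; rfl
    change _ = F (MvPolynomial.monomial m 1) 1
    rw [hm, map_mul, map_list_prod, map_list_prod, List.map_ofFn, List.map_ofFn]
    simp only [Function.comp_def, h1, h2]
  rw [hlin]
  rfl

theorem ordering_one (q : ℝ) (d : ℕ) : ordering q d 1 = 1 := by
  obtain ⟨F, -, hO⟩ := exists_evaluation q d
  simp [hO]

theorem ordering_X_mul (q : ℝ) (d : ℕ) (x : Fin d ⊕ Fin d) (p : Poly d) :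
    ordering q d (MvPolynomial.X x * p) = opFamily q d x (ordering q d p) := by
  obtain ⟨F, hX, hO⟩ := exists_evaluation q d
  simp [hO, hX]

theorem opFamily_bracket_cre (q : ℝ) (d : ℕ) (j : Fin d) (x : Fin d ⊕ Fin d) (w : Weyl d) :
    opFamily q d x w * cre d j - cre d j * opFamily q d x w =
      opFamily q d x (w * cre d j - cre d j * w) + if x = Sum.inl j then w else 0 := by
  rcases x with k | k
  · have e1 : ann d k * (cre d j * w) = cre d j * (ann d k * w) + if k = j then w else 0 := by
      rw [← mul_assoc, ann_cre', add_mul, mul_assoc]; split_ifs <;> simp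
    have e2 : w * (ann d k * cre d j) = w * (cre d j * ann d k) + if k = j then w else 0 := by
      rw [ann_cre', mul_add]; split_ifs <;> simp
    simp only [opFamily, Sum.elim_inl, opM_apply, mul_sub, sub_mul, add_mul, mul_add,
      mul_smul_comm, smul_mul_assoc, mul_assoc, e1, e2, Sum.inl.injEq]
    module
  · have e1 : cre d k * (cre d j * w) = cre d j * (cre d k * w) := by
      rw [← mul_assoc, cre_cre, mul_assoc]
    have e2 : w * (cre d k * cre d j) = w * (cre d j * cre d k) := by rw [cre_cre]
    simp only [opFamily, Sum.elim_inr, opMplus_apply, mul_sub, sub_mul, add_mul, mul_add,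
      mul_smul_comm, smul_mul_assoc, mul_assoc, e1, e2, reduceCtorEq, if_false]
    module

theorem opFamily_bracket_ann (q : ℝ) (d : ℕ) (j : Fin d) (x : Fin d ⊕ Fin d) (w : Weyl d) :
    ann d j * opFamily q d x w - opFamily q d x w * ann d j =
      opFamily q d x (ann d j * w - w * ann d j) + if x = Sum.inr j then w else 0 := by
  rcases x with k | k
  · have e1 : ann d k * (ann d j * w) = ann d j * (ann d k * w) := by
      rw [← mul_assoc, ann_ann, mul_assoc]
    have e2 : w * (ann d k * ann d j) = w * (ann d j * ann d k) := by rw [ann_ann]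
    simp only [opFamily, Sum.elim_inl, opM_apply, mul_sub, sub_mul, add_mul, mul_add,
      mul_smul_comm, smul_mul_assoc, mul_assoc, e1, e2, reduceCtorEq, if_false]
    module
  · have e1 : ann d j * (cre d k * w) = cre d k * (ann d j * w) + if k = j then w else 0 := by
      rw [← mul_assoc, ann_cre', add_mul, mul_assoc]
      by_cases h : k = j
      · simp [h]
      · simp [h, Ne.symm h]
    have e2 : w * (ann d j * cre d k) = w * (cre d k * ann d j) + if k = j then w else 0 := by
      rw [ann_cre', mul_add]
      by_cases h : k = j
      · simp [h]
      · simp [h, Ne.symm h]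
    simp only [opFamily, Sum.elim_inr, opMplus_apply, mul_sub, sub_mul, add_mul, mul_add,
      mul_smul_comm, smul_mul_assoc, mul_assoc, e1, e2, Sum.inr.injEq]
    module

/-- `O_q(∂p/∂z_j) = -[a_j⁺, O_q p]`. -/
theorem ordering_pderiv_inl (q : ℝ) (d : ℕ) (j : Fin d) (p : Poly d) :
    ordering q d (MvPolynomial.pderiv (Sum.inl j) p) =
      ordering q d p * cre d j - cre d j * ordering q d p := by
  induction p using MvPolynomial.induction_on with
  | C a =>
    have : (MvPolynomial.C a : Poly d) = a • 1 := by simp [MvPolynomial.smul_eq_C_mul]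
    simp [this, ordering_one]
  | add p r hp hr => simp only [map_add, hp, hr, add_mul, mul_add]; abel
  | mul_X p x hp =>
    rw [mul_comm p, ordering_X_mul, opFamily_bracket_cre, ← hp, Derivation.leibniz, map_add,
      smul_eq_mul, smul_eq_mul, ordering_X_mul, MvPolynomial.pderiv_X, Pi.single_apply]
    congr 1
    split_ifs <;> simp

/-- `O_q(∂p/∂z̄_j) = [a_j, O_q p]`. -/
theorem ordering_pderiv_inr (q : ℝ) (d : ℕ) (j : Fin d) (p : Poly d) :
    ordering q d (MvPolynomial.pderiv (Sum.inr j) p) =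
      ann d j * ordering q d p - ordering q d p * ann d j := by
  induction p using MvPolynomial.induction_on with
  | C a =>
    have : (MvPolynomial.C a : Poly d) = a • 1 := by simp [MvPolynomial.smul_eq_C_mul]
    simp [this, ordering_one]
  | add p r hp hr => simp only [map_add, hp, hr, add_mul, mul_add]; abel
  | mul_X p x hp =>
    rw [mul_comm p, ordering_X_mul, opFamily_bracket_ann, ← hp, Derivation.leibniz, map_add,
      smul_eq_mul, smul_eq_mul, ordering_X_mul, MvPolynomial.pderiv_X, Pi.single_apply]
    congr 1
    split_ifs <;> simp

/-- The generators of the Weyl algebra acting on polynomials, `a_j` as `∂/∂x_j` and `a_j⁺` as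
multiplication by `x_j`. -/
noncomputable def fockGen (d : ℕ) : Fin d ⊕ Fin d → Module.End ℂ (MvPolynomial (Fin d) ℂ) :=
  Sum.elim (fun j => (MvPolynomial.pderiv j).toLinearMap)
    (fun j => LinearMap.mulLeft ℂ (MvPolynomial.X j))

/-- The representation of the Weyl algebra on polynomials. -/
noncomputable def fock (d : ℕ) : Weyl d →ₐ[ℂ] Module.End ℂ (MvPolynomial (Fin d) ℂ) :=
  RingQuot.liftAlgHom ℂ ⟨FreeAlgebra.lift ℂ (fockGen d), by
    intro x y h
    induction h with
    | mixed j k =>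
      apply LinearMap.ext
      intro p
      by_cases h : j = k
      · subst h
        simp [fockGen, Module.End.mul_apply, Derivation.leibniz, MvPolynomial.pderiv_X]
      · simp [fockGen, Module.End.mul_apply, Derivation.leibniz, MvPolynomial.pderiv_X, h,
          Ne.symm h]
    | lower j k =>
      apply LinearMap.ext
      intro p
      simp only [fockGen, map_sub, map_mul, FreeAlgebra.lift_ι_apply, Sum.elim_inl,
        LinearMap.sub_apply, Module.End.mul_apply, map_zero, LinearMap.zero_apply]
      have h : ⁅(MvPolynomial.pderiv j :
          Derivation ℂ (MvPolynomial (Fin d) ℂ) (MvPolynomial (Fin d) ℂ)),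
          MvPolynomial.pderiv (R := ℂ) k⁆ = 0 := by
        refine MvPolynomial.derivation_ext (R := ℂ) fun i => ?_
        rw [Derivation.commutator_apply]
        rw [MvPolynomial.pderiv_X, MvPolynomial.pderiv_X, Pi.single_apply, Pi.single_apply]
        split_ifs <;> simp
      have := congrArg (fun D => D p) h
      simpa [Derivation.commutator_apply] using this
    | raise j k =>
      apply LinearMap.ext
      intro p
      simp only [fockGen, map_sub, map_mul, FreeAlgebra.lift_ι_apply, Sum.elim_inr,
        LinearMap.sub_apply, Module.End.mul_apply, map_zero, LinearMap.zero_apply,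
        LinearMap.mulLeft_apply]
      ring⟩

theorem fock_ann (d : ℕ) (j : Fin d) (p : MvPolynomial (Fin d) ℂ) :
    fock d (ann d j) p = MvPolynomial.pderiv j p := by
  simp [fock, ann, fockGen]

theorem fock_cre (d : ℕ) (j : Fin d) (p : MvPolynomial (Fin d) ℂ) :
    fock d (cre d j) p = MvPolynomial.X j * p := by
  simp [fock, cre, fockGen]

instance weyl_nontrivial (d : ℕ) : Nontrivial (Weyl d) :=
  (fock d).toRingHom.domain_nontrivial

/-- A polynomial all of whose partial derivatives vanish is constant. -/
theorem eq_C_of_pderiv_eq_zero {σ : Type} (p : MvPolynomial σ ℂ)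
    (h : ∀ i, MvPolynomial.pderiv i p = 0) : p = MvPolynomial.C (p.coeff 0) := by
  classical
  ext m
  rw [MvPolynomial.coeff_C]
  split_ifs with hm
  · rw [hm]
  · obtain ⟨i, hi⟩ : ∃ i, m i ≠ 0 := by
      by_contra hcon
      push Not at hcon
      exact hm (Finsupp.ext fun i => (hcon i).symm)
    have h1 := congrArg (MvPolynomial.coeff (m - Finsupp.single i 1)) (h i)
    rw [MvPolynomial.coeff_pderiv] at h1
    have h2 : m - Finsupp.single i 1 + Finsupp.single i 1 = m := by
      apply tsub_add_cancel_of_le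
      rw [Finsupp.single_le_iff]
      omega
    rw [h2, MvPolynomial.coeff_zero] at h1
    rcases mul_eq_zero.mp h1 with h3 | h3
    · exact h3
    · exact absurd h3 (Nat.cast_add_one_ne_zero _)

theorem ordering_injective (q : ℝ) (d : ℕ) : Function.Injective (ordering q d) := by
  rw [injective_iff_map_eq_zero]
  have key : ∀ n : ℕ, ∀ p : Poly d, p.totalDegree ≤ n → ordering q d p = 0 → p = 0 := by
    intro n
    induction n with
    | zero =>
      intro p hp h0
      rw [Nat.le_zero, MvPolynomial.totalDegree_eq_zero_iff_eq_C] at hp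
      rw [hp, ← mul_one (MvPolynomial.C _), ← MvPolynomial.smul_eq_C_mul, map_smul,
        ordering_one, smul_eq_zero] at h0
      rw [hp, h0.resolve_right one_ne_zero, map_zero]
    | succ n ih =>
      intro p hp h0
      have hd : ∀ x, MvPolynomial.pderiv x p = 0 := by
        intro x
        apply ih
        · rw [MvPolynomial.totalDegree]
          refine Finset.sup_le fun m hm => ?_
          rw [MvPolynomial.mem_support_iff, MvPolynomial.coeff_pderiv] at hm
          have h1 := MvPolynomial.le_totalDegree
            (MvPolynomial.mem_support_iff.mpr (left_ne_zero_of_mul hm))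
          rw [Finsupp.sum_add_index' (fun _ => rfl) (fun _ _ _ => rfl),
            Finsupp.sum_single_index rfl] at h1
          omega
        · rcases x with j | j
          · rw [ordering_pderiv_inl, h0, zero_mul, mul_zero, sub_zero]
          · rw [ordering_pderiv_inr, h0, zero_mul, mul_zero, sub_zero]
      have hp := eq_C_of_pderiv_eq_zero p hd
      rw [hp, ← mul_one (MvPolynomial.C _), ← MvPolynomial.smul_eq_C_mul, map_smul,
        ordering_one, smul_eq_zero] at h0
      rw [hp, h0.resolve_right one_ne_zero, map_zero]
  intro p
  exact key _ p le_rfl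

theorem ordering_surjective (q : ℝ) (d : ℕ) : Function.Surjective (ordering q d) := by
  have hleft : ∀ u w : Weyl d, w ∈ LinearMap.range (ordering q d) →
      u * w ∈ LinearMap.range (ordering q d) := by
    intro u
    obtain ⟨u, rfl⟩ := RingQuot.mkAlgHom_surjective ℂ (CCR d) u
    induction u using FreeAlgebra.induction with
    | grade0 r =>
      intro w hw
      rw [AlgHom.commutes, ← Algebra.smul_def]
      exact Submodule.smul_mem _ _ hw
    | grade1 x =>
      rintro _ ⟨p, rfl⟩
      rcases x with j | j
      · refine ⟨MvPolynomial.X (Sum.inl j) * p + (q : ℂ) • MvPolynomial.pderiv (Sum.inr j) p, ?_⟩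
        rw [map_add, map_smul, ordering_X_mul, ordering_pderiv_inr, opFamily, Sum.elim_inl,
          opM_apply]
        change _ = ann d j * _
        module
      · refine ⟨MvPolynomial.X (Sum.inr j) * p -
          (1 - (q : ℂ)) • MvPolynomial.pderiv (Sum.inl j) p, ?_⟩
        rw [map_sub, map_smul, ordering_X_mul, ordering_pderiv_inl, opFamily, Sum.elim_inr,
          opMplus_apply]
        change _ = cre d j * _
        module
    | mul x y hx hy =>
      intro w hw
      rw [map_mul, mul_assoc]
      exact hx _ (hy _ hw)
    | add x y hx hy =>
      intro w hw
      rw [map_add, add_mul]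
      exact Submodule.add_mem _ (hx _ hw) (hy _ hw)
  intro w
  have := hleft w 1 ⟨1, ordering_one q d⟩
  rwa [mul_one] at this

/-- The `q`-ordering map as a linear isomorphism. -/
noncomputable def orderingEquiv (q : ℝ) (d : ℕ) : Poly d ≃ₗ[ℂ] Weyl d :=
  LinearEquiv.ofBijective (ordering q d) ⟨ordering_injective q d, ordering_surjective q d⟩

/-- The endomorphism `𝓡_q` of the Weyl algebra determined by `O_q (r² p) = 𝓡_q (O_q p)`. -/
noncomputable def opR (q : ℝ) (d : ℕ) : Module.End ℂ (Weyl d) :=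
  (orderingEquiv q d).conj (LinearMap.mulLeft ℂ (radiusSq d))

theorem opR_ordering (q : ℝ) (d : ℕ) (p : Poly d) :
    opR q d (ordering q d p) = ordering q d (radiusSq d * p) := by
  have h : (orderingEquiv q d).symm (ordering q d p) = p :=
    (orderingEquiv q d).symm_apply_apply p
  rw [opR, LinearEquiv.conj_apply_apply, h]
  rfl

theorem opR_apply (q : ℝ) (d : ℕ) (w : Weyl d) :
    opR q d w = ∑ j, opM q d j (opMplus q d j w) := by
  obtain ⟨p, rfl⟩ := ordering_surjective q d w
  rw [opR_ordering, radiusSq, Finset.sum_mul, map_sum]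
  refine Finset.sum_congr rfl fun j _ => ?_
  rw [mul_assoc, ordering_X_mul, ordering_X_mul]
  rfl

/-- The basis elements `η_k = 𝓡_q^k I`. -/
noncomputable def eta (q : ℝ) (d k : ℕ) : Weyl d := (opR q d ^ k) 1

/-! ### The radial elements are polynomials of the number operator -/

theorem ann_mul_number (d : ℕ) (j : Fin d) :
    ann d j * number d = (number d + 1) * ann d j := by
  rw [number, Finset.mul_sum, add_mul, Finset.sum_mul, one_mul]
  have : ∀ k, ann d j * (cre d k * ann d k) =
      cre d k * ann d k * ann d j + if j = k then ann d j else 0 := by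
    intro k
    rw [← mul_assoc, ann_cre', add_mul, mul_assoc, mul_assoc, ann_ann d j k]
    by_cases h : j = k
    · simp [h]
    · simp [h]
  simp [this, Finset.sum_add_distrib]

theorem number_mul_cre (d : ℕ) (j : Fin d) :
    number d * cre d j = cre d j * (number d + 1) := by
  rw [number, Finset.sum_mul, mul_add, Finset.mul_sum, mul_one]
  have : ∀ k, cre d k * ann d k * cre d j =
      cre d j * (cre d k * ann d k) + if j = k then cre d j else 0 := by
    intro k
    rw [mul_assoc, ann_cre', mul_add, ← mul_assoc, cre_cre d k j, mul_assoc]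
    by_cases h : j = k
    · simp [h]
    · simp [h, Ne.symm h]
  simp [this, Finset.sum_add_distrib]

theorem ann_mul_aeval (d : ℕ) (j : Fin d) (p : Polynomial ℂ) :
    ann d j * Polynomial.aeval (number d) p =
      Polynomial.aeval (number d + 1) p * ann d j := by
  induction p using Polynomial.induction_on' with
  | add p r hp hr => simp only [map_add, mul_add, add_mul, hp, hr]
  | monomial n c =>
    simp only [Polynomial.aeval_monomial]
    rw [← mul_assoc, ← Algebra.commutes, mul_assoc, mul_assoc]
    congr 1
    exact (SemiconjBy.pow_right (ann_mul_number d j : SemiconjBy _ _ _) n)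

theorem ann_cre_sum (d : ℕ) : ∑ j, ann d j * cre d j = number d + (d : Weyl d) := by
  simp [ann_cre', number, Finset.sum_add_distrib]

theorem aeval_mul_ann (d : ℕ) (j : Fin d) (p : Polynomial ℂ) :
    Polynomial.aeval (number d) p * ann d j =
      ann d j * Polynomial.aeval (number d - 1) p := by
  have h := ann_mul_aeval d j (p.comp (Polynomial.X - 1))
  simp only [Polynomial.aeval_comp, map_sub, Polynomial.aeval_X, map_one,
    add_sub_cancel_right] at h
  exact h.symm

/-- The polynomial form of the action of `𝓡_q` on polynomials of the number operator. -/
theorem opR_aeval_number (q : ℝ) (d : ℕ) (p : Polynomial ℂ) :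
    opR q d (Polynomial.aeval (number d) p) = Polynomial.aeval (number d)
      (Polynomial.C ((q : ℂ) * (1 - q)) * (2 * Polynomial.X + Polynomial.C (d : ℂ)) * p
        + Polynomial.C ((1 - (q : ℂ)) ^ 2) * (Polynomial.X + Polynomial.C (d : ℂ)) *
            p.comp (Polynomial.X + 1)
        + Polynomial.C ((q : ℂ) ^ 2) * Polynomial.X * p.comp (Polynomial.X - 1)) := by
  have hd : (d : Weyl d) = Polynomial.aeval (number d) (Polynomial.C (d : ℂ)) := by simp
  have hN : number d = Polynomial.aeval (number d) (Polynomial.X : Polynomial ℂ) := by simp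
  have h1 : ∑ j, ann d j * (cre d j * Polynomial.aeval (number d) p) =
      Polynomial.aeval (number d) ((Polynomial.X + Polynomial.C (d : ℂ)) * p) := by
    simp_rw [← mul_assoc]
    rw [← Finset.sum_mul, ann_cre_sum, map_mul, map_add, ← hd, ← hN]
  have h2 : ∑ j, ann d j * (Polynomial.aeval (number d) p * cre d j) =
      Polynomial.aeval (number d)
        (p.comp (Polynomial.X + 1) * (Polynomial.X + Polynomial.C (d : ℂ))) := by
    simp_rw [← mul_assoc, ann_mul_aeval, mul_assoc]
    rw [← Finset.mul_sum, ann_cre_sum, map_mul, map_add, ← hd, ← hN, Polynomial.aeval_comp]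
    simp
  have h3 : ∑ j, cre d j * Polynomial.aeval (number d) p * ann d j =
      Polynomial.aeval (number d) (Polynomial.X * p.comp (Polynomial.X - 1)) := by
    simp_rw [mul_assoc, aeval_mul_ann, ← mul_assoc]
    rw [← Finset.sum_mul, map_mul, ← hN, Polynomial.aeval_comp]
    simp [number]
  have h4 : ∑ j, Polynomial.aeval (number d) p * cre d j * ann d j =
      Polynomial.aeval (number d) (p * Polynomial.X) := by
    simp_rw [mul_assoc]
    rw [← Finset.mul_sum, map_mul, ← hN]
    rfl
  rw [opR_apply]
  simp only [opM_apply, opMplus_apply, mul_add, add_mul, mul_smul_comm, smul_mul_assoc,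
    smul_add, Finset.sum_add_distrib, ← Finset.smul_sum, h1, h2, h3, h4]
  simp only [← map_smul, ← map_add]
  congr 1
  simp only [Polynomial.smul_eq_C_mul, map_mul, map_pow, map_sub, map_one]
  ring

/-- Every `η_k` is a polynomial of the number operator. -/
theorem exists_omega (q : ℝ) (d k : ℕ) :
    ∃ p : Polynomial ℂ, Polynomial.aeval (number d) p = eta q d k := by
  induction k with
  | zero => exact ⟨1, by simp [eta]⟩
  | succ k ih =>
    obtain ⟨p, hp⟩ := ih
    refine ⟨_, (opR_aeval_number q d p).symm.trans ?_⟩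
    rw [hp, eta, eta, pow_succ', Module.End.mul_apply]

/-- A polynomial is determined by its value at the number operator. -/
theorem aeval_number_injective (d : ℕ) (hd : 1 ≤ d) :
    Function.Injective fun p : Polynomial ℂ => Polynomial.aeval (number d) p := by
  intro p r h
  have hN : ∀ n : ℕ, fock d (number d) (MvPolynomial.X ⟨0, hd⟩ ^ n) =
      (n : ℂ) • MvPolynomial.X ⟨0, hd⟩ ^ n := by
    intro n
    rw [number, map_sum, LinearMap.sum_apply, Finset.sum_eq_single ⟨0, hd⟩]
    · rw [map_mul, Module.End.mul_apply, fock_ann, fock_cre, Derivation.leibniz_pow,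
        MvPolynomial.pderiv_X_self]
      rcases n with _ | n
      · simp
      · simp only [Nat.add_sub_cancel, smul_eq_mul, mul_one, nsmul_eq_mul,
          MvPolynomial.smul_eq_C_mul, map_natCast]
        ring
    · intro j _ hj
      rw [map_mul, Module.End.mul_apply, fock_ann, fock_cre, Derivation.leibniz_pow,
        MvPolynomial.pderiv_X_of_ne hj.symm]
      simp
    · simp
  have hp : ∀ (p : Polynomial ℂ) (n : ℕ),
      fock d (Polynomial.aeval (number d) p) (MvPolynomial.X ⟨0, hd⟩ ^ n) =
        p.eval (n : ℂ) • MvPolynomial.X ⟨0, hd⟩ ^ n := by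
    intro p n
    rw [← Polynomial.aeval_algHom_apply]
    exact Module.End.aeval_apply_of_hasEigenvector
      ⟨Module.End.mem_eigenspace_iff.mpr (hN n), pow_ne_zero n (MvPolynomial.X_ne_zero _)⟩
  apply Polynomial.eq_of_infinite_eval_eq
  refine Set.Infinite.mono ?_ (Set.infinite_range_of_injective (Nat.cast_injective (R := ℂ)))
  rintro _ ⟨n, rfl⟩
  have h1 := hp p n
  have h' : Polynomial.aeval (number d) p = Polynomial.aeval (number d) r := h
  rw [h', hp r n] at h1
  exact (smul_left_injective ℂ (pow_ne_zero n (MvPolynomial.X_ne_zero _)) h1).symm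

/-- The polynomial `ω_k` with `η_k = ω_k(N)` (unique for `1 ≤ d`). -/
noncomputable def omega (q : ℝ) (d k : ℕ) : Polynomial ℂ := (exists_omega q d k).choose

/-- For `1 ≤ d`, `ω_k` is the only polynomial with `ω_k(N) = η_k`. -/
theorem omega_unique (q : ℝ) (d k : ℕ) (hd : 1 ≤ d) (p : Polynomial ℂ) :
    Polynomial.aeval (number d) p = eta q d k ↔ p = omega q d k := by
  have h := (exists_omega q d k).choose_spec
  constructor
  · intro hp
    exact aeval_number_injective d hd (hp.trans h.symm)
  · rintro rfl
    exact h

/-- `g_k(λ) = i^k α^k / k! · ω_k(t)`, where `α = (q(1-q))^{-1/2}` and `t` is given by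
`λ = i α (t + (1-q) d)`. -/
noncomputable def g (q : ℝ) (d k : ℕ) (l : ℂ) : ℂ :=
  let α : ℂ := (((q * (1 - q)) ^ (-(1 / 2) : ℝ) : ℝ) : ℂ)
  Complex.I ^ k * α ^ k / (k.factorial : ℂ) *
    (omega q d k).eval (-(Complex.I / α) * l - (1 - (q : ℂ)) * d)

/-! ### Hypergeometric polynomials -/

/-- The shifted factorial `(x)_n = x (x + 1) ⋯ (x + n - 1)`. -/
noncomputable def shifted (x : ℂ) (n : ℕ) : ℂ := (ascPochhammer ℂ n).eval x

/-- The generalized hypergeometric series `₃F₂(a₁, a₂, a₃; b₁, b₂; z)`. -/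
noncomputable def hyp32 (a₁ a₂ a₃ b₁ b₂ z : ℂ) : ℂ :=
  ∑' n : ℕ, shifted a₁ n * shifted a₂ n * shifted a₃ n / (shifted b₁ n * shifted b₂ n) *
    (z ^ n / (n.factorial : ℂ))

/-- The continuous Hahn polynomial `p_k(x; a, b, c, d)`. -/
noncomputable def continuousHahn (k : ℕ) (x a b c d : ℂ) : ℂ :=
  Complex.I ^ k * (shifted (a + c) k * shifted (a + d) k / (k.factorial : ℂ)) *
    hyp32 (-k) (k + a + b + c + d - 1) (a + Complex.I * x) (a + c) (a + d) 1

/-- The Meixner–Pollaczek polynomial `P_n^{(a)}(x; φ)`, in the normalization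
`e^{inφ} ₂F₁(-n, a + ix; 2a; 1 - e^{-2iφ})`. -/
noncomputable def meixnerPollaczek (n : ℕ) (a x φ : ℂ) : ℂ :=
  Complex.exp (Complex.I * n * φ) *
    ordinaryHypergeometric (-(n : ℂ)) (a + Complex.I * x) (2 * a)
      (1 - Complex.exp (-2 * Complex.I * φ))

end WeylRadial

/-!
Put `x = d/2 + iλ/2`, so that `t = -x`. At `q = 1/2` the action of `𝓡_q` on polynomials of the
number operator is a recursion of `ω_k` with the shifts `x ± 1`, and its solution is
`ω_k(-x) = (d)_k 2^{-k} ₂F₁(-k, x; d; 2)` (`eval_omega_half`).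

All identities for `F_k(x) = ₂F₁(-k, x; d; 2)` come from the linear functional `umbral d x` with
`u^j ↦ (x)_j / (d)_j`, under which `F_k(x)` is the image of `(1 - 2u)^k`. Multiplication by `x` and
the shifts `x ↦ x ± 1` become first-order differential operators in `u`, so the three-term
recurrence (`meixnerSum_succ`), the difference equation
`x F_k(x + 1) + (d - x) F_k(x - 1) = (d + 2k) F_k(x)` (`meixnerSum_difference`) and the recursion
for `ω_k` (`meixnerSum_raise`) are identities between powers of `1 - 2u`. The Meixner–Pollaczek
formula is then the definition of `F_k`; the continuous Hahn formula is the quadratic transformation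
`₂F₁(-k, x; d; 2) = ₃F₂(-k, k + d, x/2; d/2, d/2 + 1/2; 1)`, which holds because the right-hand side
satisfies the same three-term recurrence, by telescoping (`sum_hahnTerm_recurrence`).

On the line `Re x = d/2` one has `|Γ(x)|² = Γ(x) Γ(d - x)`. For a polynomial `P`, moving the contour
of `∫ Γ(x) Γ(d + 1 - x) P(x) dx` by `1` (`integral_gammaIntegrand_line`) shows that the difference
operator `p ↦ x p(x + 1) + (d - x) p(x - 1)` is symmetric for the bilinear pairing with this weight
(`integral_diffOp_mul`). The shift is justified by the reflection formula, which makes the integrand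
a polynomial times `π / sin (π x)`. Both `F_m(x)` and `conj F_n(x) = F_n(d - x)` are eigenfunctions,
with eigenvalues `d + 2m` and `d + 2n`, so they are orthogonal when `m ≠ n`.
-/

namespace WeylRadial

open Polynomial

/-! ### Meixner sums through an umbral functional -/

theorem shifted_zero (x : ℂ) : shifted x 0 = 1 := by simp [shifted]

theorem shifted_succ (x : ℂ) (n : ℕ) : shifted x (n + 1) = shifted x n * (x + n) := by
  rw [shifted, ascPochhammer_succ_eval, shifted]

theorem shifted_succ_left (x : ℂ) (n : ℕ) : shifted x (n + 1) = x * shifted (x + 1) n := by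
  rw [shifted, ascPochhammer_succ_left, shifted]
  simp

theorem shifted_ne_zero {c : ℂ} (hc : ∀ j : ℕ, c + j ≠ 0) (n : ℕ) : shifted c n ≠ 0 := by
  induction n with
  | zero => simp [shifted_zero]
  | succ n ih => rw [shifted_succ]; exact mul_ne_zero ih (hc n)

theorem shifted_neg_eq_zero {n k : ℕ} (h : n < k) : shifted (-(n : ℂ)) k = 0 :=
  ascPochhammer_eval_neg_coe_nat_of_lt h

theorem shifted_neg_natCast (n k : ℕ) :
    shifted (-(n : ℂ)) k = (-1) ^ k * n.choose k * k.factorial := by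
  induction k with
  | zero => simp [shifted_zero]
  | succ k ih =>
    rw [shifted_succ, ih, Nat.factorial_succ]
    have h : (n.choose (k + 1) : ℂ) * (k + 1) = n.choose k * (n - k) := by
      rcases le_or_gt k n with hk | hk
      · have := Nat.choose_succ_right_eq n k
        rw [← Nat.cast_sub hk]
        exact_mod_cast this
      · simp [Nat.choose_eq_zero_of_lt hk, Nat.choose_eq_zero_of_lt (hk.trans (Nat.lt_succ_self k))]
    push_cast
    linear_combination (-1) ^ k * (k.factorial : ℂ) * h

/-- The linear functional on `ℂ[u]` with `u ^ j ↦ (x)_j / (c)_j`. It turns `(1 - 2u)^n` into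
`₂F₁(-n, x; c; 2)`. -/
noncomputable def umbral (c x : ℂ) : ℂ[X] →ₗ[ℂ] ℂ :=
  Polynomial.lsum fun j => (shifted x j / shifted c j) • LinearMap.id

theorem umbral_monomial (c x : ℂ) (j : ℕ) (a : ℂ) :
    umbral c x (monomial j a) = a * (shifted x j / shifted c j) := by
  simp [umbral, Polynomial.lsum_apply, Polynomial.sum_monomial_index, mul_comm]

variable {c : ℂ}

theorem shifted_div_succ (hc : ∀ j : ℕ, c + j ≠ 0) (y : ℂ) (j : ℕ) :
    (c + j) * (y / shifted c (j + 1)) = y / shifted c j := by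
  have h := shifted_ne_zero hc j
  have h' := hc j
  rw [shifted_succ]
  field_simp

/-- Under the umbral functional, multiplication by `x` becomes the operator
`c u - u (1 - u) d/du`. -/
theorem mul_umbral (hc : ∀ j : ℕ, c + j ≠ 0) (x : ℂ) (p : ℂ[X]) :
    x * umbral c x p = umbral c x (C c * (X * p) - (X - X ^ 2) * derivative p) := by
  induction p using Polynomial.induction_on' with
  | add p r hp hr =>
    rw [map_add, mul_add, hp, hr, ← map_add]
    congr 1
    simp only [map_add]
    ring
  | monomial j a =>
    have h : C c * (X * monomial j a) - (X - X ^ 2) * derivative (monomial j a) =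
        monomial (j + 1) ((c + j) * a) - monomial j (j * a) := by
      rcases j with _ | j
      · simp [← C_mul_X_eq_monomial, mul_assoc]
      · simp only [derivative_monomial, sub_mul, pow_two, mul_assoc, X_mul_monomial,
          C_mul_monomial, Nat.add_sub_cancel, add_mul, map_add]
        rw [mul_comm a]
        ring
    rw [h, map_sub]
    simp only [umbral_monomial]
    rw [shifted_succ x]
    linear_combination (-a) * shifted_div_succ hc (shifted x j * (x + j)) j

/-- Under the umbral functional, `f ↦ x f(x + 1)` becomes `c u + u² d/du`. -/
theorem mul_umbral_add_one (hc : ∀ j : ℕ, c + j ≠ 0) (x : ℂ) (p : ℂ[X]) :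
    x * umbral c (x + 1) p = umbral c x (C c * (X * p) + X ^ 2 * derivative p) := by
  induction p using Polynomial.induction_on' with
  | add p r hp hr =>
    rw [map_add, mul_add, hp, hr, ← map_add]
    congr 1
    simp only [map_add]
    ring
  | monomial j a =>
    have h : C c * (X * monomial j a) + X ^ 2 * derivative (monomial j a) =
        monomial (j + 1) ((c + j) * a) := by
      rcases j with _ | j
      · simp [← C_mul_X_eq_monomial, mul_assoc]
      · simp only [derivative_monomial, pow_two, mul_assoc, X_mul_monomial,
          C_mul_monomial, Nat.add_sub_cancel, add_mul, map_add]
        rw [mul_comm a]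
    rw [h]
    simp only [umbral_monomial]
    rw [shifted_succ_left x]
    linear_combination (-a) * shifted_div_succ hc (x * shifted (x + 1) j) j

/-- Under the umbral functional, `f ↦ (c - x) f(x - 1)` becomes `c (1 - u) - (1 - u)² d/du`. -/
theorem mul_umbral_sub_one (hc : ∀ j : ℕ, c + j ≠ 0) (x : ℂ) (p : ℂ[X]) :
    (c - x) * umbral c (x - 1) p =
      umbral c x (C c * ((1 - X) * p) - (1 - X) ^ 2 * derivative p) := by
  induction p using Polynomial.induction_on' with
  | add p r hp hr =>
    rw [map_add, mul_add, hp, hr, ← map_add]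
    congr 1
    simp only [map_add]
    ring
  | monomial j a =>
    rcases j with _ | j
    · have h : C c * ((1 - X) * monomial 0 a) - (1 - X) ^ 2 * derivative (monomial 0 a) =
          monomial 0 (c * a) - monomial 1 (c * a) := by
        simp [sub_mul, mul_sub, ← C_mul_X_eq_monomial, mul_assoc]
      rw [h, map_sub]
      simp only [umbral_monomial, shifted_zero]
      have := hc 0
      simp only [Nat.cast_zero, add_zero] at this
      simp [shifted]
      field_simp
    · have h : C c * ((1 - X) * monomial (j + 1) a) -
          (1 - X) ^ 2 * derivative (monomial (j + 1) a) =
          monomial (j + 1) ((c + 2 * (j + 1)) * a) - monomial (j + 2) ((c + (j + 1)) * a) -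
            monomial j ((j + 1) * a) := by
        have e : (1 - X : ℂ[X]) ^ 2 = 1 - X - X + X * X := by ring
        simp only [derivative_monomial, e, sub_mul, mul_sub, add_mul, one_mul, mul_assoc,
          X_mul_monomial, C_mul_monomial, Nat.add_sub_cancel, map_add, two_mul]
        rw [mul_comm a]
        push_cast
        simp only [add_mul, one_mul, map_add]
        ring_nf
      rw [h, map_sub, map_sub]
      simp only [umbral_monomial]
      have e1 := shifted_div_succ hc (shifted (x - 1) (j + 1)) j
      have e2 := shifted_div_succ hc (shifted x (j + 2)) (j + 1)
      have e3 := shifted_succ_left (x - 1) j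
      rw [sub_add_cancel] at e3
      have h0 := shifted_ne_zero hc j
      have h1 := hc j
      have h2 := hc (j + 1)
      push_cast at e2 h2
      rw [e3, shifted_succ x (j + 1), shifted_succ x j, shifted_succ c (j + 1), shifted_succ c j]
      push_cast
      field_simp
      ring

/-- The Meixner sum `₂F₁(-n, x; c; 2)`. -/
noncomputable def meixnerSum (c : ℂ) (n : ℕ) (x : ℂ) : ℂ := umbral c x ((1 - 2 * X) ^ n)

theorem umbral_C_mul (c x a : ℂ) (p : ℂ[X]) : umbral c x (C a * p) = a * umbral c x p := by
  rw [← smul_eq_C_mul, map_smul, smul_eq_mul]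

theorem derivative_base_pow (n : ℕ) :
    derivative ((1 - 2 * X : ℂ[X]) ^ n) = -C (2 * n : ℂ) * (1 - 2 * X) ^ (n - 1) := by
  rw [derivative_pow]
  simp only [derivative_sub, derivative_one, derivative_mul, derivative_X, derivative_ofNat,
    map_mul, map_natCast, map_ofNat]
  ring

/-- The three-term recurrence. -/
theorem meixnerSum_succ (hc : ∀ j : ℕ, c + j ≠ 0) (n : ℕ) (x : ℂ) :
    (c + n) * meixnerSum c (n + 1) x =
      (c - 2 * x) * meixnerSum c n x + n * meixnerSum c (n - 1) x := by
  have h := mul_umbral hc x ((1 - 2 * X) ^ n)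
  have key : C (2 : ℂ) * (C c * (X * (1 - 2 * X) ^ n) -
      (X - X ^ 2) * derivative ((1 - 2 * X) ^ n)) =
      C c * (1 - 2 * X) ^ n - C (c + n) * (1 - 2 * X) ^ (n + 1) +
        C (n : ℂ) * (1 - 2 * X) ^ (n - 1) := by
    rw [derivative_base_pow]
    rcases n with _ | n
    · simp only [CharP.cast_eq_zero, mul_zero, map_zero, neg_zero, zero_mul, map_add, map_ofNat]
      ring
    · simp only [Nat.add_sub_cancel, map_add, map_mul, map_ofNat]
      ring
  have h2 := congrArg (umbral c x) key
  rw [umbral_C_mul, ← h, map_add, map_sub, umbral_C_mul, umbral_C_mul, umbral_C_mul] at h2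
  simp only [meixnerSum]
  linear_combination h2

/-- The second-order difference equation: Meixner sums are eigenfunctions of
`f ↦ x f(x + 1) + (c - x) f(x - 1)`. -/
theorem meixnerSum_difference (hc : ∀ j : ℕ, c + j ≠ 0) (n : ℕ) (x : ℂ) :
    x * meixnerSum c n (x + 1) + (c - x) * meixnerSum c n (x - 1) =
      (c + 2 * n) * meixnerSum c n x := by
  simp only [meixnerSum]
  rw [mul_umbral_add_one hc, mul_umbral_sub_one hc, ← map_add, ← umbral_C_mul,
    derivative_base_pow]
  congr 1
  rcases n with _ | n
  · simp; ring
  · simp only [Nat.add_sub_cancel, map_add, map_mul, map_ofNat]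
    ring

/-- The raising relation, which involves the same shifts as the action of `𝓡_{1/2}` on
polynomials of the number operator. -/
theorem meixnerSum_raise (hc : ∀ j : ℕ, c + j ≠ 0) (n : ℕ) (x : ℂ) :
    2 * (c + n) * meixnerSum c (n + 1) x = (c - 2 * x) * meixnerSum c n x +
      (c - x) * meixnerSum c n (x - 1) - x * meixnerSum c n (x + 1) := by
  have h := meixnerSum_succ hc n x
  suffices h' : (c + n) * meixnerSum c (n + 1) x + n * meixnerSum c (n - 1) x =
      (c - x) * meixnerSum c n (x - 1) - x * meixnerSum c n (x + 1) by
    linear_combination h + h'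
  simp only [meixnerSum]
  rw [mul_umbral_add_one hc, mul_umbral_sub_one hc, ← map_sub, ← umbral_C_mul, ← umbral_C_mul,
    ← map_add, derivative_base_pow]
  congr 1
  rcases n with _ | n
  · simp; ring
  · simp only [Nat.add_sub_cancel, map_add, map_mul, map_ofNat]
    ring

theorem meixnerSum_zero (c x : ℂ) : meixnerSum c 0 x = 1 := by
  have := umbral_monomial c x 0 1
  simpa [meixnerSum, shifted_zero] using this

theorem meixnerSum_eq_hypergeometric (c : ℂ) (n : ℕ) (x : ℂ) :
    meixnerSum c n x = ordinaryHypergeometric (-(n : ℂ)) x c 2 := by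
  have h : (1 - 2 * X : ℂ[X]) ^ n =
      ∑ j ∈ Finset.range (n + 1), monomial j ((-2) ^ j * (n.choose j : ℂ)) := by
    rw [sub_eq_add_neg, add_comm, add_pow]
    refine Finset.sum_congr rfl fun j _ => ?_
    rw [← C_mul_X_pow_eq_monomial]
    have : (-(2 * X) : ℂ[X]) = C (-2) * X := by simp [map_ofNat C 2]
    rw [this, mul_pow]
    simp
    ring
  rw [meixnerSum, h, map_sum, ordinaryHypergeometric_eq_tsum]
  beta_reduce
  rw [tsum_eq_sum (s := Finset.range (n + 1))]
  · refine Finset.sum_congr rfl fun j _ => ?_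
    have e := shifted_neg_natCast n j
    have hf : (j.factorial : ℂ) ≠ 0 := by exact_mod_cast j.factorial_ne_zero
    rw [umbral_monomial]
    simp only [shifted] at e ⊢
    rw [e, smul_eq_mul, neg_pow 2 j]
    field_simp
  · intro j hj
    have e := shifted_neg_eq_zero (n := n) (k := j) (by simpa using hj)
    simp only [shifted] at e
    simp [e]

end WeylRadial

namespace WeylRadial

open Polynomial

/-! ### The quadratic transformation to a `₃F₂` -/

/-- A term of `₃F₂(-n, n + c, y; c/2, c/2 + 1/2; 1)`. -/
noncomputable def hahnTerm (c y n : ℂ) (j : ℕ) : ℂ :=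
  shifted (-n) j * shifted (n + c) j * shifted y j /
    (shifted (c / 2) j * shifted (c / 2 + 1 / 2) j) * (1 ^ j / (j.factorial : ℂ))

/-- Partial sums telescope: the three-term recurrence of `meixnerSum` (with `x = 2y`) holds for
partial sums of the `₃F₂` up to one boundary term. -/
theorem sum_hahnTerm_recurrence {c : ℂ} (hc : ∀ j : ℕ, c + j ≠ 0) (y n : ℂ) (N : ℕ) :
    (c + n) * ∑ j ∈ Finset.range (N + 1), hahnTerm c y (n + 1) j -
        (c - 4 * y) * ∑ j ∈ Finset.range (N + 1), hahnTerm c y n j -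
        n * ∑ j ∈ Finset.range (N + 1), hahnTerm c y (n - 1) j =
      4 * (y + N) * hahnTerm c y n N := by
  induction N with
  | zero => simp [hahnTerm, shifted_zero]
  | succ N ih =>
    rw [Finset.sum_range_succ _ (N + 1), Finset.sum_range_succ _ (N + 1),
      Finset.sum_range_succ _ (N + 1)]
    suffices h : (c + n) * hahnTerm c y (n + 1) (N + 1) -
        (c - 4 * y) * hahnTerm c y n (N + 1) - n * hahnTerm c y (n - 1) (N + 1) =
        4 * (y + (N + 1 : ℕ)) * hahnTerm c y n (N + 1) - 4 * (y + N) * hahnTerm c y n N by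
      linear_combination ih + h
    have hc1 : ∀ j : ℕ, c / 2 + j ≠ 0 := fun j h => hc (2 * j) (by
      push_cast; linear_combination 2 * h)
    have hc2 : ∀ j : ℕ, c / 2 + 1 / 2 + j ≠ 0 := fun j h => hc (2 * j + 1) (by
      push_cast; linear_combination 2 * h)
    have a1 := shifted_ne_zero hc1 N
    have a2 := shifted_ne_zero hc2 N
    have a3 := hc1 N
    have a4 := hc2 N
    have a5 : (N.factorial : ℂ) ≠ 0 := by exact_mod_cast N.factorial_ne_zero
    have a6 : (N : ℂ) + 1 ≠ 0 := by exact_mod_cast N.succ_ne_zero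
    -- With the prefactors `n` and `c + n`, all terms are polynomial multiples of
    -- `(-n)_N (n + c)_N`, so nothing has to be divided by factors that may vanish.
    have b1 : shifted (-(n + 1)) (N + 1) = -(n + 1) * shifted (-n) N := by
      rw [shifted_succ_left]; congr 2; ring
    have b2 : n * shifted (-(n - 1)) (N + 1) =
        -(shifted (-n) N * (-n + N) * (-n + N + 1)) := by
      have := shifted_succ_left (-n) (N + 1)
      rw [shifted_succ, shifted_succ] at this
      push_cast at this
      rw [show -(n - 1) = -n + 1 by ring]
      linear_combination this
    have b3 : (c + n) * shifted (n + 1 + c) (N + 1) =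
        shifted (n + c) N * (n + c + N) * (n + c + N + 1) := by
      have := shifted_succ_left (n + c) (N + 1)
      rw [shifted_succ, shifted_succ] at this
      push_cast at this
      rw [show n + 1 + c = n + c + 1 by ring]
      linear_combination -this
    have b4 : shifted (n - 1 + c) (N + 1) = (n + c - 1) * shifted (n + c) N := by
      rw [shifted_succ_left]; congr 2 <;> ring
    have t1 : (c + n) * hahnTerm c y (n + 1) (N + 1) =
        (shifted (-(n + 1)) (N + 1)) * ((c + n) * shifted (n + 1 + c) (N + 1)) *
          shifted y (N + 1) / (shifted (c / 2) (N + 1) * shifted (c / 2 + 1 / 2) (N + 1)) *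
          (1 ^ (N + 1) / ((N + 1).factorial : ℂ)) := by
      rw [hahnTerm]; ring
    have t2 : n * hahnTerm c y (n - 1) (N + 1) =
        (n * shifted (-(n - 1)) (N + 1)) * shifted (n - 1 + c) (N + 1) *
          shifted y (N + 1) / (shifted (c / 2) (N + 1) * shifted (c / 2 + 1 / 2) (N + 1)) *
          (1 ^ (N + 1) / ((N + 1).factorial : ℂ)) := by
      rw [hahnTerm]; ring
    rw [t1, t2, b1, b2, b3, b4]
    simp only [hahnTerm, shifted_succ, Nat.factorial_succ, one_pow, Nat.cast_mul, Nat.cast_add,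
      Nat.cast_one]
    generalize shifted (-n) N = S
    generalize shifted (n + c) N = T
    generalize shifted y N = Y
    generalize shifted (c / 2) N = U at *
    generalize shifted (c / 2 + 1 / 2) N = V at *
    generalize (N.factorial : ℂ) = F at *
    generalize (N : ℂ) = M at *
    generalize hP : c / 2 + M = P at *
    generalize hQ : c / 2 + 1 / 2 + M = Q at *
    have hK : S * T * Y / (U * V) * (1 / F) =
        P * Q * (M + 1) * (S * T * Y / (U * P * (V * Q)) * (1 / ((M + 1) * F))) := by
      field_simp
    rw [hK]
    obtain rfl : Q = P + 1 / 2 := by rw [← hP, ← hQ]; ring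
    obtain rfl : c = 2 * (P - M) := by rw [← hP]; ring
    simp only [div_eq_mul_inv, one_mul]
    ring

theorem hyp32_eq_sum (c y : ℂ) (n N : ℕ) (h : n < N) :
    hyp32 (-n) (n + c) y (c / 2) (c / 2 + 1 / 2) 1 =
      ∑ j ∈ Finset.range N, hahnTerm c y n j := by
  rw [hyp32, tsum_eq_sum (s := Finset.range N)]
  · rfl
  · intro j hj
    rw [shifted_neg_eq_zero (h.trans_le (by simpa using hj))]
    simp

/-- The quadratic transformation
`₂F₁(-n, x; c; 2) = ₃F₂(-n, n + c, x/2; c/2, c/2 + 1/2; 1)`. -/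
theorem meixnerSum_eq_hyp32 {c : ℂ} (hc : ∀ j : ℕ, c + j ≠ 0) (n : ℕ) (x : ℂ) :
    meixnerSum c n x = hyp32 (-n) (n + c) (x / 2) (c / 2) (c / 2 + 1 / 2) 1 := by
  have hrec (n : ℕ) : (c + n) * hyp32 (-(n + 1 : ℕ)) ((n + 1 : ℕ) + c) (x / 2) (c / 2)
        (c / 2 + 1 / 2) 1 =
      (c - 2 * x) * hyp32 (-n) (n + c) (x / 2) (c / 2) (c / 2 + 1 / 2) 1 +
        n * hyp32 (-(n - 1 : ℕ)) ((n - 1 : ℕ) + c) (x / 2) (c / 2) (c / 2 + 1 / 2) 1 := by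
    rw [hyp32_eq_sum c _ (n + 1) (n + 2 + 1) (by lia), hyp32_eq_sum c _ n (n + 2 + 1) (by lia),
      hyp32_eq_sum c _ (n - 1) (n + 2 + 1) (by lia)]
    have h := sum_hahnTerm_recurrence hc (x / 2) n (n + 2)
    have h0 : hahnTerm c (x / 2) n (n + 2) = 0 := by
      rw [hahnTerm, shifted_neg_eq_zero (by lia)]; simp
    rw [h0] at h
    rcases n with _ | n
    · simp only [Nat.cast_zero, zero_mul, zero_add, Nat.cast_one] at h ⊢
      linear_combination h
    · simp only [Nat.add_sub_cancel]
      push_cast at h ⊢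
      rw [add_sub_cancel_right] at h
      linear_combination h
  have h0 : hyp32 (-(0 : ℕ)) ((0 : ℕ) + c) (x / 2) (c / 2) (c / 2 + 1 / 2) 1 = 1 := by
    rw [hyp32_eq_sum c _ 0 1 one_pos]
    simp [hahnTerm, shifted_zero]
  induction n using Nat.strong_induction_on with
  | _ n ih =>
    rcases n with _ | n
    · rw [meixnerSum_zero, h0]
    · apply mul_left_cancel₀ (hc n)
      rw [meixnerSum_succ hc, hrec, ih n n.lt_succ_self, ih (n - 1) (by lia)]

/-! ### Identification of the polynomials `ω_k` at `q = 1/2` -/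

theorem aeval_omega (q : ℝ) (d k : ℕ) : aeval (number d) (omega q d k) = eta q d k :=
  (exists_omega q d k).choose_spec

theorem natCast_add_natCast_ne_zero {d : ℕ} (hd : 1 ≤ d) (j : ℕ) : (d : ℂ) + j ≠ 0 := by
  exact_mod_cast (by lia : d + j ≠ 0)

theorem omega_zero (q : ℝ) {d : ℕ} (hd : 1 ≤ d) : omega q d 0 = 1 :=
  ((omega_unique q d 0 hd 1).1 (by simp [eta])).symm

theorem eval_omega_half_succ {d : ℕ} (hd : 1 ≤ d) (k : ℕ) (x : ℂ) :
    4 * (omega (1 / 2) d (k + 1)).eval (-x) =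
      (d - 2 * x) * (omega (1 / 2) d k).eval (-x) +
        (d - x) * (omega (1 / 2) d k).eval (-(x - 1)) -
        x * (omega (1 / 2) d k).eval (-(x + 1)) := by
  have h := opR_aeval_number (1 / 2) d (omega (1 / 2) d k)
  have e : opR (1 / 2) d (eta (1 / 2) d k) = eta (1 / 2) d (k + 1) := by
    rw [eta, eta, pow_succ', Module.End.mul_apply]
  rw [aeval_omega, e] at h
  rw [← (omega_unique (1 / 2) d (k + 1) hd _).1 h.symm]
  simp only [eval_add, eval_mul, eval_C, eval_X, eval_comp, eval_sub, eval_one, eval_ofNat]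
  push_cast
  rw [show -(x - 1) = -x + 1 by ring, show -(x + 1) = -x - 1 by ring]
  ring

theorem eval_omega_half {d : ℕ} (hd : 1 ≤ d) (k : ℕ) (x : ℂ) :
    (omega (1 / 2) d k).eval (-x) = shifted d k / 2 ^ k * meixnerSum d k x := by
  induction k generalizing x with
  | zero => simp [omega_zero _ hd, shifted_zero, meixnerSum_zero]
  | succ k ih =>
    have h := eval_omega_half_succ hd k x
    have h' := meixnerSum_raise (natCast_add_natCast_ne_zero hd) k x
    rw [ih, ih, ih] at h
    rw [shifted_succ, pow_succ]
    linear_combination h / 4 - shifted d k / 2 ^ k / 4 * h'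

theorem g_half (d k : ℕ) (l : ℂ) :
    g (1 / 2) d k l = (2 * Complex.I) ^ k / (k.factorial : ℂ) *
      (omega (1 / 2) d k).eval (-((d : ℂ) / 2 + Complex.I * (l / 2))) := by
  have h : ((1 / 2 * (1 - 1 / 2) : ℝ) ^ (-(1 / 2) : ℝ)) = 2 := by
    rw [show (1 / 2 * (1 - 1 / 2) : ℝ) = 2 ^ (-2 : ℝ) by norm_num [Real.rpow_neg],
      ← Real.rpow_mul (by norm_num)]
    norm_num
  simp only [g, h]
  push_cast
  rw [mul_pow]
  congr 2 <;> ring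

theorem g_half_eq_meixnerSum {d : ℕ} (hd : 1 ≤ d) (k : ℕ) (l : ℂ) :
    g (1 / 2) d k l = Complex.I ^ k * (shifted d k / (k.factorial : ℂ)) *
      meixnerSum d k ((d : ℂ) / 2 + Complex.I * (l / 2)) := by
  rw [g_half, eval_omega_half hd, mul_pow]
  field_simp

theorem g_half_eq_meixnerPollaczek {d : ℕ} (hd : 1 ≤ d) (k : ℕ) (l : ℂ) :
    g (1 / 2) d k l = shifted (d : ℂ) k / (k.factorial : ℂ) *
      meixnerPollaczek k ((d : ℂ) / 2) (l / 2) ((Real.pi : ℂ) / 2) := by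
  have e1 : Complex.exp (Complex.I * k * ((Real.pi : ℂ) / 2)) = Complex.I ^ k := by
    rw [show Complex.I * k * ((Real.pi : ℂ) / 2) = k * (Real.pi / 2 * Complex.I) by ring,
      Complex.exp_nat_mul, Complex.exp_pi_div_two_mul_I]
  have e2 : 1 - Complex.exp (-2 * Complex.I * ((Real.pi : ℂ) / 2)) = 2 := by
    rw [show -2 * Complex.I * ((Real.pi : ℂ) / 2) = -(Real.pi * Complex.I) by ring,
      Complex.exp_neg, Complex.exp_pi_mul_I]
    norm_num
  rw [g_half_eq_meixnerSum hd, meixnerSum_eq_hypergeometric, meixnerPollaczek, e1, e2,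
    mul_div_cancel₀ _ (two_ne_zero' ℂ)]
  ring

theorem g_half_eq_continuousHahn {d : ℕ} (hd : 1 ≤ d) (k : ℕ) (l : ℂ) :
    g (1 / 2) d k l =
      shifted (d : ℂ) k / (shifted ((d : ℂ) / 2) k * shifted ((d : ℂ) / 2 + 1 / 2) k) *
        continuousHahn k (l / 4) ((d : ℂ) / 4) ((d : ℂ) / 4 + 1 / 2)
          ((d : ℂ) / 4) ((d : ℂ) / 4 + 1 / 2) := by
  have hc := natCast_add_natCast_ne_zero hd
  have a1 : shifted ((d : ℂ) / 2) k ≠ 0 := shifted_ne_zero (fun j h => hc (2 * j) (by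
    push_cast; linear_combination 2 * h)) k
  have a2 : shifted ((d : ℂ) / 2 + 1 / 2) k ≠ 0 := shifted_ne_zero (fun j h => hc (2 * j + 1) (by
    push_cast; linear_combination 2 * h)) k
  rw [g_half_eq_meixnerSum hd, meixnerSum_eq_hyp32 hc, continuousHahn,
    show (d : ℂ) / 4 + d / 4 = d / 2 by ring,
    show (d : ℂ) / 4 + (d / 4 + 1 / 2) = d / 2 + 1 / 2 by ring,
    show (k : ℂ) + d / 4 + (d / 4 + 1 / 2) + d / 4 + (d / 4 + 1 / 2) - 1 = k + d by ring,
    show (d : ℂ) / 4 + Complex.I * (l / 4) = (d / 2 + Complex.I * (l / 2)) / 2 by ring]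
  generalize shifted ((d : ℂ) / 2) k = U at *
  generalize shifted ((d : ℂ) / 2 + 1 / 2) k = V at *
  field_simp

end WeylRadial

namespace WeylRadial

open Polynomial Filter Topology MeasureTheory

/-! ### Contour shift for the weight `Γ(z) Γ(m + 1 - z)` -/

theorem exp_sub_exp_le_norm_sin (z : ℂ) :
    (Real.exp |z.im| - Real.exp (-|z.im|)) / 2 ≤ ‖Complex.sin z‖ := by
  have e1 : ‖Complex.exp (-z * Complex.I)‖ = Real.exp z.im := by simp [Complex.norm_exp]
  have e2 : ‖Complex.exp (z * Complex.I)‖ = Real.exp (-z.im) := by simp [Complex.norm_exp]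
  have h : ‖Complex.sin z‖ =
      ‖Complex.exp (-z * Complex.I) - Complex.exp (z * Complex.I)‖ / 2 := by
    rw [Complex.sin, norm_div, norm_mul, Complex.norm_I, mul_one, Complex.norm_two]
  rw [h]
  have h1 := norm_sub_norm_le (Complex.exp (-z * Complex.I)) (Complex.exp (z * Complex.I))
  have h2 := norm_sub_norm_le (Complex.exp (z * Complex.I)) (Complex.exp (-z * Complex.I))
  rw [norm_sub_rev] at h2
  rw [e1, e2] at h1 h2
  rcases abs_cases z.im with ⟨h, -⟩ | ⟨h, -⟩ <;> rw [h]
  · linarith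
  · rw [neg_neg]; linarith

theorem exp_le_norm_sin_pi_mul (z : ℂ) (hz : 1 ≤ |z.im|) :
    Real.exp |z.im| / 4 ≤ ‖Complex.sin (Real.pi * z)‖ := by
  refine le_trans ?_ (exp_sub_exp_le_norm_sin _)
  have him : |((Real.pi : ℂ) * z).im| = Real.pi * |z.im| := by
    simp [abs_mul, abs_of_pos Real.pi_pos]
  rw [him]
  have hle : |z.im| ≤ Real.pi * |z.im| := by nlinarith [Real.pi_gt_three, abs_nonneg z.im]
  have h1 := Real.exp_le_exp.2 hle
  have h2 := Real.exp_le_exp.2 (neg_le_neg hle)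
  have h3 : 2 ≤ Real.exp |z.im| := by linarith [Real.add_one_le_exp |z.im|]
  have h4 : Real.exp |z.im| * Real.exp (-|z.im|) = 1 := by rw [← Real.exp_add]; simp
  nlinarith [Real.exp_pos (-|z.im|)]

theorem exists_norm_eval_le (P : ℂ[X]) :
    ∃ A : ℝ, 0 ≤ A ∧ ∀ z : ℂ, ‖P.eval z‖ ≤ A * (1 + ‖z‖) ^ P.natDegree := by
  refine ⟨∑ i ∈ Finset.range (P.natDegree + 1), ‖P.coeff i‖, by positivity, fun z => ?_⟩
  rw [eval_eq_sum_range, Finset.sum_mul]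
  refine (norm_sum_le _ _).trans (Finset.sum_le_sum fun i hi => ?_)
  rw [norm_mul, norm_pow]
  gcongr
  calc ‖z‖ ^ i ≤ (1 + ‖z‖) ^ i := by gcongr; linarith
    _ ≤ (1 + ‖z‖) ^ P.natDegree :=
      pow_le_pow_right₀ (by linarith [norm_nonneg z]) (by simpa [Nat.lt_succ_iff] using hi)

/-- In a vertical strip polynomials grow slower than `exp |Im z|`, with room to spare. -/
theorem exists_norm_eval_le_exp (P : ℂ[X]) (B : ℝ) :
    ∃ C : ℝ, 0 ≤ C ∧ ∀ z : ℂ, |z.re| ≤ B →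
      ‖P.eval z‖ ≤ C * Real.exp |z.im| * (1 + z.im ^ 2)⁻¹ := by
  obtain ⟨A, hA, h⟩ := exists_norm_eval_le P
  refine ⟨A * ((P.natDegree + 2).factorial * Real.exp (1 + B)), by positivity, fun z hz => ?_⟩
  rw [← div_eq_mul_inv, le_div_iff₀ (by positivity)]
  set t := 1 + B + |z.im| with ht
  have hB : 0 ≤ B := (abs_nonneg _).trans hz
  have h1 : 1 + ‖z‖ ≤ t := by linarith [Complex.norm_le_abs_re_add_abs_im z]
  have h2 : 1 + z.im ^ 2 ≤ t ^ 2 := by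
    rw [← sq_abs z.im]; nlinarith [abs_nonneg z.im]
  have ht0 : 0 ≤ t := by positivity
  have h3 : t ^ (P.natDegree + 2) ≤ (P.natDegree + 2).factorial * Real.exp t := by
    have := Real.pow_div_factorial_le_exp t ht0 (P.natDegree + 2)
    rwa [div_le_iff₀' (by positivity)] at this
  calc ‖P.eval z‖ * (1 + z.im ^ 2) ≤ A * (1 + ‖z‖) ^ P.natDegree * (1 + z.im ^ 2) := by
        gcongr; exact h z
    _ ≤ A * t ^ P.natDegree * t ^ 2 := by gcongr
    _ = A * t ^ (P.natDegree + 2) := by ring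
    _ ≤ A * ((P.natDegree + 2).factorial * Real.exp t) := by gcongr
    _ = _ := by rw [ht, Real.exp_add]; ring

theorem Gamma_add_natCast {z : ℂ} (hz : ∀ j : ℕ, z + j ≠ 0) (m : ℕ) :
    Complex.Gamma (z + m) = shifted z m * Complex.Gamma z := by
  induction m with
  | zero => simp [shifted_zero]
  | succ m ih =>
    rw [Nat.cast_succ, ← add_assoc, Complex.Gamma_add_one _ (hz m), ih, shifted_succ]
    ring

/-- The integrand of the contour integrals, for a polynomial `P`. -/
noncomputable def gammaIntegrand (m : ℕ) (P : ℂ[X]) (z : ℂ) : ℂ :=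
  Complex.Gamma z * Complex.Gamma (m + 1 - z) * P.eval z

theorem exists_norm_gammaIntegrand_le (m : ℕ) (P : ℂ[X]) (B : ℝ) :
    ∃ C : ℝ, 0 ≤ C ∧ ∀ z : ℂ, |z.re| ≤ B → 1 ≤ |z.im| →
      ‖gammaIntegrand m P z‖ ≤ C * (1 + z.im ^ 2)⁻¹ := by
  obtain ⟨C, hC, h⟩ := exists_norm_eval_le_exp ((ascPochhammer ℂ m).comp (1 - X) * P) B
  refine ⟨4 * Real.pi * C, by positivity, fun z hz hz1 => ?_⟩
  have him : z.im ≠ 0 := by intro h0; rw [h0, abs_zero] at hz1; linarith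
  -- The reflection formula turns the product of Gamma functions into `π / sin (π z)`.
  have e : gammaIntegrand m P z = ((ascPochhammer ℂ m).comp (1 - X) * P).eval z *
      (Real.pi / Complex.sin (Real.pi * z)) := by
    rw [gammaIntegrand, ← Complex.Gamma_mul_Gamma_one_sub,
      show (m : ℂ) + 1 - z = 1 - z + m by ring, Gamma_add_natCast]
    · simp only [shifted, eval_mul, eval_comp, eval_sub, eval_one, eval_X]
      ring
    · intro j hj
      have := congrArg Complex.im hj
      simp at this
      exact him this
  have hs := exp_le_norm_sin_pi_mul z hz1
  have hs0 : 0 < ‖Complex.sin (Real.pi * z)‖ := lt_of_lt_of_le (by positivity) hs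
  rw [e, norm_mul, norm_div, Complex.norm_of_nonneg Real.pi_pos.le, ← mul_div_assoc,
    div_le_iff₀ hs0]
  calc _ ≤ C * Real.exp |z.im| * (1 + z.im ^ 2)⁻¹ * Real.pi := by gcongr; exact h z hz
    _ = 4 * Real.pi * C * (1 + z.im ^ 2)⁻¹ * (Real.exp |z.im| / 4) := by ring
    _ ≤ _ := by gcongr

theorem differentiableAt_gammaIntegrand (m : ℕ) (P : ℂ[X]) {z : ℂ} (h0 : 0 < z.re)
    (h1 : z.re < m + 1) : DifferentiableAt ℂ (gammaIntegrand m P) z := by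
  have hG {w : ℂ} (hw : 0 < w.re) : DifferentiableAt ℂ Complex.Gamma w := by
    refine Complex.differentiableAt_Gamma w fun k hk => ?_
    rw [hk] at hw
    simp only [Complex.neg_re, Complex.natCast_re] at hw
    linarith [k.cast_nonneg (α := ℝ)]
  have h2 : DifferentiableAt ℂ (fun z : ℂ => Complex.Gamma (m + 1 - z)) z :=
    DifferentiableAt.comp z (hG (by simpa using h1)) (by fun_prop)
  exact ((hG h0).mul h2).mul P.differentiable.differentiableAt

variable {m : ℕ} {a b : ℝ}

theorem continuous_gammaIntegrand_line (P : ℂ[X]) (h0 : 0 < a) (h1 : a < m + 1) :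
    Continuous fun y : ℝ => gammaIntegrand m P (a + y * Complex.I) := by
  refine continuous_iff_continuousAt.2 fun y => ?_
  have h := (differentiableAt_gammaIntegrand m P (z := a + y * Complex.I) (by simpa using h0)
    (by simpa using h1)).continuousAt
  exact ContinuousAt.comp (f := fun y : ℝ => (a : ℂ) + y * Complex.I) h (by fun_prop)

theorem integrable_gammaIntegrand_line (P : ℂ[X]) (h0 : 0 < a) (h1 : a < m + 1) :
    Integrable fun y : ℝ => gammaIntegrand m P (a + y * Complex.I) := by
  refine (continuous_gammaIntegrand_line P h0 h1).locallyIntegrable.integrable_of_isBigO_cocompact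
    (g := fun y : ℝ => (1 + y ^ 2)⁻¹) ?_ (integrable_inv_one_add_sq.integrableAtFilter _)
  obtain ⟨C, hC, h⟩ := exists_norm_gammaIntegrand_le m P |a|
  refine Asymptotics.IsBigO.of_bound C ?_
  have : ∀ᶠ y : ℝ in cocompact ℝ, 1 ≤ |y| := by
    simpa using (tendsto_norm_cocompact_atTop (E := ℝ)).eventually_ge_atTop 1
  filter_upwards [this] with y hy
  have := h (a + y * Complex.I) (by simp) (by simpa using hy)
  rw [Real.norm_of_nonneg (by positivity)]
  simpa using this

/-- The vertical line of integration can be moved within the strip `0 < Re z < m + 1`. -/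
theorem integral_gammaIntegrand_line (P : ℂ[X]) (h0 : 0 < a) (hab : a ≤ b) (h1 : b < m + 1) :
    ∫ y : ℝ, gammaIntegrand m P (a + y * Complex.I) =
      ∫ y : ℝ, gammaIntegrand m P (b + y * Complex.I) := by
  have lim {s : ℝ} (hs0 : 0 < s) (hs1 : s < m + 1) :
      Tendsto (fun T : ℝ => ∫ y in (-T)..T, gammaIntegrand m P (s + y * Complex.I)) atTop
        (𝓝 (∫ y : ℝ, gammaIntegrand m P (s + y * Complex.I))) :=
    intervalIntegral_tendsto_integral (integrable_gammaIntegrand_line P hs0 hs1)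
      tendsto_neg_atTop_atBot tendsto_id
  have hdiff := ((lim (h0.trans_le hab) h1).sub (lim h0 (hab.trans_lt h1))).const_mul Complex.I
  -- The horizontal sides of the rectangle contribute nothing in the limit.
  have hzero : Tendsto (fun T : ℝ => Complex.I *
      ((∫ y in (-T)..T, gammaIntegrand m P (b + y * Complex.I)) -
        ∫ y in (-T)..T, gammaIntegrand m P (a + y * Complex.I))) atTop (𝓝 0) := by
    obtain ⟨C, hC, h⟩ := exists_norm_gammaIntegrand_le m P b
    have side (s : ℝ) (T : ℝ) (hT : 1 ≤ T) (hs : |s| = T) :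
        ‖∫ x in a..b, gammaIntegrand m P (x + s * Complex.I)‖ ≤
          C * (1 + T ^ 2)⁻¹ * |b - a| := by
      refine intervalIntegral.norm_integral_le_of_norm_le_const fun x hx => ?_
      rw [Set.uIoc_of_le hab] at hx
      have := h (x + s * Complex.I)
        (by simpa [abs_of_pos (h0.trans hx.1)] using hx.2) (by simpa [hs] using hT)
      rw [← hs, sq_abs]
      simpa using this
    have hlim : Tendsto (fun T : ℝ => 2 * (C * (1 + T ^ 2)⁻¹ * |b - a|)) atTop (𝓝 0) := by
      have : Tendsto (fun T : ℝ => (1 + T ^ 2)⁻¹) atTop (𝓝 0) :=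
        tendsto_inv_atTop_zero.comp
          (tendsto_atTop_add_const_left _ _ (tendsto_pow_atTop two_ne_zero))
      simpa using ((this.const_mul C).mul_const |b - a|).const_mul 2
    refine squeeze_zero_norm' ?_ hlim
    filter_upwards [eventually_ge_atTop (1 : ℝ)] with T hT
    have hrect := Complex.integral_boundary_rect_eq_zero_of_differentiableOn
      (gammaIntegrand m P) (a + (-T : ℝ) * Complex.I) (b + T * Complex.I) (by
        intro z hz
        have hre := hz.1
        simp only [Set.mem_preimage, Complex.add_re, Complex.ofReal_re, Complex.mul_re,
          Complex.ofReal_im, Complex.I_re, Complex.I_im, mul_zero, mul_one, sub_zero, add_zero,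
          Set.uIcc_of_le hab, Set.mem_Icc] at hre
        exact (differentiableAt_gammaIntegrand m P (h0.trans_le hre.1)
          (hre.2.trans_lt h1)).differentiableWithinAt)
    simp only [Complex.add_re, Complex.ofReal_re, Complex.mul_re, Complex.ofReal_im, Complex.I_re,
      Complex.I_im, mul_zero, mul_one, sub_zero, add_zero, zero_add, Complex.add_im,
      Complex.mul_im, smul_eq_mul] at hrect
    have e : Complex.I * ((∫ y in (-T)..T, gammaIntegrand m P (b + y * Complex.I)) -
        ∫ y in (-T)..T, gammaIntegrand m P (a + y * Complex.I)) =
        (∫ x in a..b, gammaIntegrand m P (x + T * Complex.I)) -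
          ∫ x in a..b, gammaIntegrand m P (x + (-T : ℝ) * Complex.I) := by
      linear_combination hrect
    rw [e]
    have hT' : |T| = T := abs_of_nonneg (by linarith)
    refine (norm_sub_le _ _).trans ?_
    linarith [side T T hT hT', side (-T) T hT (by rw [abs_neg, hT'])]
  have h := tendsto_nhds_unique hdiff hzero
  rw [mul_eq_zero, or_iff_right Complex.I_ne_zero, sub_eq_zero] at h
  exact h.symm

end WeylRadial

namespace WeylRadial

open Polynomial MeasureTheory

/-! ### Orthogonality -/

/-- The line `Re x = d/2`. -/
noncomputable def critLine (d : ℕ) (y : ℝ) : ℂ := d / 2 + Complex.I * y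

theorem conj_critLine (d : ℕ) (y : ℝ) :
    (starRingEnd ℂ) (critLine d y) = d - critLine d y := by
  simp only [critLine, map_add, map_div₀, map_mul, map_natCast, map_ofNat, Complex.conj_I,
    Complex.conj_ofReal]
  ring

/-- The weight `|Γ(x)|²` on the line `Re x = d/2`, in the form `Γ(x) Γ(d - x)`. -/
noncomputable def gammaWeight (d : ℕ) (y : ℝ) : ℂ :=
  Complex.Gamma (critLine d y) * Complex.Gamma (d - critLine d y)

theorem gammaWeight_eq_norm_sq (d : ℕ) (y : ℝ) :
    gammaWeight d y = ((‖Complex.Gamma (critLine d y)‖ ^ 2 : ℝ) : ℂ) := by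
  rw [gammaWeight, ← conj_critLine, Complex.Gamma_conj, Complex.mul_conj']
  push_cast
  rfl

theorem gammaIntegrand_critLine (m : ℕ) (P : ℂ[X]) (y : ℝ) :
    gammaIntegrand m P (((m + 1 : ℕ) / 2 : ℝ) + y * Complex.I) =
      P.eval (critLine (m + 1) y) * gammaWeight (m + 1) y := by
  have h : (((m + 1 : ℕ) / 2 : ℝ) : ℂ) + y * Complex.I = critLine (m + 1) y := by
    rw [critLine]; push_cast; ring
  rw [h, gammaIntegrand, gammaWeight]
  push_cast
  ring

theorem integrable_eval_mul_gammaWeight {d : ℕ} (hd : 1 ≤ d) (P : ℂ[X]) :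
    Integrable fun y : ℝ => P.eval (critLine d y) * gammaWeight d y := by
  obtain ⟨m, rfl⟩ := Nat.exists_eq_add_of_le' hd
  have := integrable_gammaIntegrand_line (m := m) (a := ((m + 1 : ℕ) / 2 : ℝ)) P
    (by positivity) (by push_cast; linarith [m.cast_nonneg (α := ℝ)])
  simpa only [gammaIntegrand_critLine] using this

theorem continuous_eval_mul_gammaWeight {d : ℕ} (hd : 1 ≤ d) (P : ℂ[X]) :
    Continuous fun y : ℝ => P.eval (critLine d y) * gammaWeight d y := by
  obtain ⟨m, rfl⟩ := Nat.exists_eq_add_of_le' hd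
  have := continuous_gammaIntegrand_line (m := m) (a := ((m + 1 : ℕ) / 2 : ℝ)) P
    (by positivity) (by push_cast; linarith [m.cast_nonneg (α := ℝ)])
  simpa only [gammaIntegrand_critLine] using this

/-- Shifting the contour of `∫ Γ(x) Γ(d + 1 - x) P(x) dx` by `1`. -/
theorem integral_shift {d : ℕ} (hd : 1 ≤ d) (P : ℂ[X]) :
    ∫ y : ℝ, ((X : ℂ[X]) * P.comp (X + 1)).eval (critLine d y) * gammaWeight d y =
      ∫ y : ℝ, ((C (d : ℂ) - X) * P).eval (critLine d y) * gammaWeight d y := by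
  have hd' : (1 : ℝ) ≤ d := by exact_mod_cast hd
  have h := integral_gammaIntegrand_line (m := d) (a := d / 2) (b := d / 2 + 1) P
    (by positivity) (by linarith) (by linarith)
  have hre (y : ℝ) : 0 < (critLine d y).re := by
    simp [critLine]; lia
  have hne {z : ℂ} (hz : 0 < z.re) : z ≠ 0 := by rintro rfl; simp at hz
  calc _ = ∫ y : ℝ, gammaIntegrand d P ((d / 2 + 1 : ℝ) + y * Complex.I) := by
        congr 1
        ext y
        have e : ((d / 2 + 1 : ℝ) : ℂ) + y * Complex.I = critLine d y + 1 := by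
          rw [critLine]; push_cast; ring
        rw [e, gammaIntegrand, gammaWeight, Complex.Gamma_add_one _ (hne (hre y)),
          show (d : ℂ) + 1 - (critLine d y + 1) = d - critLine d y by ring]
        simp only [eval_mul, eval_comp, eval_add, eval_X, eval_one]
        ring
    _ = ∫ y : ℝ, gammaIntegrand d P ((d / 2 : ℝ) + y * Complex.I) := h.symm
    _ = _ := by
        congr 1
        ext y
        have e : ((d / 2 : ℝ) : ℂ) + y * Complex.I = critLine d y := by
          rw [critLine]; push_cast; ring
        have hs : (d : ℂ) - critLine d y ≠ 0 := hne (by simp [critLine]; linarith)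
        rw [e, gammaIntegrand, gammaWeight,
          show (d : ℂ) + 1 - critLine d y = d - critLine d y + 1 by ring,
          Complex.Gamma_add_one _ hs]
        simp only [eval_mul, eval_sub, eval_X, eval_C]
        ring

/-- The difference operator `p ↦ x p(x + 1) + (d - x) p(x - 1)`. -/
noncomputable def diffOp (d : ℕ) (p : ℂ[X]) : ℂ[X] :=
  X * p.comp (X + 1) + (C (d : ℂ) - X) * p.comp (X - 1)

/-- The difference operator is symmetric for the bilinear pairing given by the weight. -/
theorem integral_diffOp_mul {d : ℕ} (hd : 1 ≤ d) (p r : ℂ[X]) :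
    ∫ y : ℝ, (diffOp d p * r).eval (critLine d y) * gammaWeight d y =
      ∫ y : ℝ, (p * diffOp d r).eval (critLine d y) * gammaWeight d y := by
  have key (p r : ℂ[X]) :
      ∫ y : ℝ, (X * p.comp (X + 1) * r).eval (critLine d y) * gammaWeight d y =
        ∫ y : ℝ, ((C (d : ℂ) - X) * p * r.comp (X - 1)).eval (critLine d y) *
          gammaWeight d y := by
    have := integral_shift hd (p * r.comp (X - 1))
    rw [mul_comp, comp_assoc] at this
    simpa [mul_assoc] using this
  have hi := integrable_eval_mul_gammaWeight hd
  have e1 : diffOp d p * r =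
      X * p.comp (X + 1) * r + (C (d : ℂ) - X) * r * p.comp (X - 1) := by
    rw [diffOp]; ring
  have e2 : p * diffOp d r =
      (C (d : ℂ) - X) * p * r.comp (X - 1) + X * r.comp (X + 1) * p := by
    rw [diffOp]; ring
  rw [e1, e2]
  simp only [eval_add (p := X * p.comp (X + 1) * r),
    eval_add (p := (C (d : ℂ) - X) * p * r.comp (X - 1)), add_mul _ _ (gammaWeight d _)]
  rw [integral_add (hi _) (hi _), integral_add (hi _) (hi _), key, key]

/-- Eigenfunctions of the difference operator with different eigenvalues are orthogonal. -/
theorem integral_mul_eq_zero_of_diffOp {d : ℕ} (hd : 1 ≤ d) {p r : ℂ[X]} {μ ν : ℂ}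
    (hp : diffOp d p = C μ * p) (hr : diffOp d r = C ν * r) (h : μ ≠ ν) :
    ∫ y : ℝ, (p * r).eval (critLine d y) * gammaWeight d y = 0 := by
  have h1 := integral_diffOp_mul hd p r
  rw [hp, hr, show p * (C ν * r) = C ν * (p * r) by ring, mul_assoc] at h1
  simp only [eval_mul (p := C _), eval_C, mul_assoc _ (eval _ (p * r)), integral_const_mul] at h1
  have h2 : (μ - ν) * ∫ y : ℝ, (p * r).eval (critLine d y) * gammaWeight d y = 0 := by
    linear_combination h1
  exact (mul_eq_zero.1 h2).resolve_left (sub_ne_zero.2 h)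

theorem eval_diffOp (d : ℕ) (p : ℂ[X]) (x : ℂ) :
    (diffOp d p).eval x = x * p.eval (x + 1) + (d - x) * p.eval (x - 1) := by
  simp [diffOp]

theorem diffOp_omega {d : ℕ} (hd : 1 ≤ d) (n : ℕ) :
    diffOp d ((omega (1 / 2) d n).comp (-X)) =
      C ((d : ℂ) + 2 * n) * (omega (1 / 2) d n).comp (-X) := by
  refine Polynomial.funext fun x => ?_
  simp only [eval_diffOp, eval_comp, eval_neg, eval_X, eval_mul, eval_C, eval_omega_half hd]
  linear_combination shifted d n / 2 ^ n *
    meixnerSum_difference (natCast_add_natCast_ne_zero hd) n x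

/-- The difference operator commutes with the reflection `x ↦ d - x`. -/
theorem diffOp_omega_reflect {d : ℕ} (hd : 1 ≤ d) (n : ℕ) :
    diffOp d ((omega (1 / 2) d n).comp (X - C (d : ℂ))) =
      C ((d : ℂ) + 2 * n) * (omega (1 / 2) d n).comp (X - C (d : ℂ)) := by
  refine Polynomial.funext fun x => ?_
  have h := congrArg (eval (d - x)) (diffOp_omega hd n)
  simp only [eval_diffOp, eval_comp, eval_neg, eval_sub, eval_X, eval_mul, eval_C] at h ⊢
  rw [show -((d : ℂ) - x + 1) = x - 1 - d by ring, show -((d : ℂ) - x - 1) = x + 1 - d by ring,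
    show -((d : ℂ) - x) = x - d by ring] at h
  linear_combination h

/-- `ω_k(1/2, d; ·)` has real coefficients, by its recursion. -/
theorem conj_eval_omega_half {d : ℕ} (hd : 1 ≤ d) (k : ℕ) (x : ℂ) :
    (starRingEnd ℂ) ((omega (1 / 2) d k).eval (-x)) =
      (omega (1 / 2) d k).eval (-(starRingEnd ℂ) x) := by
  induction k generalizing x with
  | zero => simp [omega_zero _ hd]
  | succ k ih =>
    have h := congrArg (starRingEnd ℂ) (eval_omega_half_succ hd k x)
    simp only [map_mul, map_add, map_sub, map_ofNat, map_natCast, ih, map_one] at h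
    rw [← eval_omega_half_succ hd] at h
    exact mul_left_cancel₀ (by norm_num : (4 : ℂ) ≠ 0) h

theorem meixnerSum_at_zero {c : ℂ} (hc : ∀ j : ℕ, c + j ≠ 0) (n : ℕ) : meixnerSum c n 0 = 1 := by
  induction n using Nat.strong_induction_on with
  | _ n ih =>
    rcases n with _ | n
    · exact meixnerSum_zero c 0
    · apply mul_left_cancel₀ (hc n)
      rw [meixnerSum_succ hc, ih n n.lt_succ_self, ih (n - 1) (by lia)]
      ring

theorem omega_half_ne_zero {d : ℕ} (hd : 1 ≤ d) (n : ℕ) : omega (1 / 2) d n ≠ 0 := by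
  intro h
  have hc := natCast_add_natCast_ne_zero hd
  have := eval_omega_half hd n 0
  rw [h, meixnerSum_at_zero hc, eval_zero, mul_one] at this
  exact div_ne_zero (shifted_ne_zero hc n) (pow_ne_zero n two_ne_zero) this.symm

theorem g_half_ofReal (d k : ℕ) (l : ℝ) :
    g (1 / 2) d k l = (2 * Complex.I) ^ k / (k.factorial : ℂ) *
      (omega (1 / 2) d k).eval (-critLine d (l / 2)) := by
  rw [g_half, critLine]
  push_cast
  rfl

theorem weight_ofReal (d : ℕ) (l : ℝ) :
    ((‖Complex.Gamma ((d : ℂ) / 2 + Complex.I * ((l : ℂ) / 2))‖ ^ 2 : ℝ) : ℂ) =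
      gammaWeight d (l / 2) := by
  rw [gammaWeight_eq_norm_sq, critLine]
  push_cast
  rfl

/-- The integrand `g_m ḡ_n ρ` is a constant multiple of a polynomial times the weight on the
line `Re x = d/2`. -/
theorem integrand_eq {d : ℕ} (hd : 1 ≤ d) (m n : ℕ) (l : ℝ) :
    g (1 / 2) d m (l : ℂ) * (starRingEnd ℂ) (g (1 / 2) d n (l : ℂ)) *
        ((‖Complex.Gamma ((d : ℂ) / 2 + Complex.I * ((l : ℂ) / 2))‖ ^ 2 : ℝ) : ℂ) =
      (2 * Complex.I) ^ m / (m.factorial : ℂ) *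
        (starRingEnd ℂ) ((2 * Complex.I) ^ n / (n.factorial : ℂ)) *
      (((omega (1 / 2) d m).comp (-X) * (omega (1 / 2) d n).comp (X - C (d : ℂ))).eval
        (critLine d (l / 2)) * gammaWeight d (l / 2)) := by
  have h : -(starRingEnd ℂ) (critLine d (l / 2)) = critLine d (l / 2) - d := by
    rw [conj_critLine, neg_sub]
  rw [weight_ofReal, g_half_ofReal, g_half_ofReal, map_mul, conj_eval_omega_half hd, h]
  simp only [eval_mul, eval_comp, eval_neg, eval_X, eval_sub, eval_C]
  ring

theorem integrable_g_half {d : ℕ} (hd : 1 ≤ d) (m n : ℕ) :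
    Integrable fun l : ℝ => g (1 / 2) d m (l : ℂ) * (starRingEnd ℂ) (g (1 / 2) d n (l : ℂ)) *
      ((‖Complex.Gamma ((d : ℂ) / 2 + Complex.I * ((l : ℂ) / 2))‖ ^ 2 : ℝ) : ℂ) := by
  simp only [integrand_eq hd]
  exact ((integrable_eval_mul_gammaWeight hd _).comp_div two_ne_zero).const_mul _

theorem integral_g_half_eq_zero {d : ℕ} (hd : 1 ≤ d) {m n : ℕ} (hmn : m ≠ n) :
    ∫ l : ℝ, g (1 / 2) d m (l : ℂ) * (starRingEnd ℂ) (g (1 / 2) d n (l : ℂ)) *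
      ((‖Complex.Gamma ((d : ℂ) / 2 + Complex.I * ((l : ℂ) / 2))‖ ^ 2 : ℝ) : ℂ) = 0 := by
  simp only [integrand_eq hd]
  rw [integral_const_mul, Measure.integral_comp_div (fun y : ℝ =>
    ((omega (1 / 2) d m).comp (-X) * (omega (1 / 2) d n).comp (X - C (d : ℂ))).eval
        (critLine d y) * gammaWeight d y),
    integral_mul_eq_zero_of_diffOp hd (diffOp_omega hd m) (diffOp_omega_reflect hd n)]
  · simp
  · simpa using hmn

theorem integral_norm_g_half_pos {d : ℕ} (hd : 1 ≤ d) (n : ℕ) :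
    0 < ∫ l : ℝ, ‖g (1 / 2) d n (l : ℂ)‖ ^ 2 *
      ‖Complex.Gamma ((d : ℂ) / 2 + Complex.I * ((l : ℂ) / 2))‖ ^ 2 := by
  have hnorm (l : ℝ) : ‖g (1 / 2) d n (l : ℂ)‖ ^ 2 *
      ‖Complex.Gamma ((d : ℂ) / 2 + Complex.I * ((l : ℂ) / 2))‖ ^ 2 =
      ‖g (1 / 2) d n (l : ℂ) * (starRingEnd ℂ) (g (1 / 2) d n (l : ℂ)) *
        ((‖Complex.Gamma ((d : ℂ) / 2 + Complex.I * ((l : ℂ) / 2))‖ ^ 2 : ℝ) : ℂ)‖ := by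
    rw [norm_mul, norm_mul, RCLike.norm_conj, Complex.norm_of_nonneg (by positivity), pow_two]
  obtain ⟨l, hl⟩ : ∃ l : ℝ, g (1 / 2) d n l ≠ 0 := by
    by_contra! hcon
    refine omega_half_ne_zero hd n (Polynomial.eq_zero_of_infinite_isRoot _
      (Set.Infinite.mono ?_ (Set.infinite_range_of_injective
        (f := fun l : ℝ => -critLine d (l / 2)) fun l l' h => ?_)))
    · rintro _ ⟨l, rfl⟩
      have h := hcon l
      rw [g_half_ofReal] at h
      exact (mul_eq_zero.1 h).resolve_left (div_ne_zero
        (pow_ne_zero n (mul_ne_zero two_ne_zero Complex.I_ne_zero))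
        (by exact_mod_cast n.factorial_ne_zero))
    · have := congrArg Complex.im h
      simp [critLine] at this
      linarith
  refine integral_pos_of_integrable_nonneg_nonzero (x := l) ?_ ?_ (fun l => by positivity) ?_
  · simp only [hnorm, integrand_eq hd]
    exact (continuous_const.mul ((continuous_eval_mul_gammaWeight hd _).comp
      (continuous_id.div_const 2))).norm
  · simp only [hnorm]
    exact (integrable_g_half hd n n).norm
  · have hG : Complex.Gamma ((d : ℂ) / 2 + Complex.I * ((l : ℂ) / 2)) ≠ 0 := by
      refine Complex.Gamma_ne_zero_of_re_pos ?_
      simp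
      lia
    positivity

end WeylRadial

theorem theorem3 (d : ℕ) (hd : 1 ≤ d) :
    (∀ (k : ℕ) (l : ℂ),
      WeylRadial.g (1 / 2) d k l =
        WeylRadial.shifted (d : ℂ) k /
            (WeylRadial.shifted ((d : ℂ) / 2) k * WeylRadial.shifted ((d : ℂ) / 2 + 1 / 2) k) *
          WeylRadial.continuousHahn k (l / 4) ((d : ℂ) / 4) ((d : ℂ) / 4 + 1 / 2)
            ((d : ℂ) / 4) ((d : ℂ) / 4 + 1 / 2)) ∧
    (∀ (k : ℕ) (l : ℂ),
      WeylRadial.g (1 / 2) d k l =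
        WeylRadial.shifted (d : ℂ) k / (k.factorial : ℂ) *
          WeylRadial.meixnerPollaczek k ((d : ℂ) / 2) (l / 2) ((Real.pi : ℂ) / 2)) ∧
    (∀ m n : ℕ,
      MeasureTheory.Integrable (fun l : ℝ =>
        WeylRadial.g (1 / 2) d m (l : ℂ) * (starRingEnd ℂ) (WeylRadial.g (1 / 2) d n (l : ℂ)) *
          ((‖Complex.Gamma ((d : ℂ) / 2 + Complex.I * ((l : ℂ) / 2))‖ ^ 2 : ℝ) : ℂ))
        MeasureTheory.volume) ∧
    (∀ m n : ℕ, m ≠ n →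
      ∫ l : ℝ,
        WeylRadial.g (1 / 2) d m (l : ℂ) * (starRingEnd ℂ) (WeylRadial.g (1 / 2) d n (l : ℂ)) *
          ((‖Complex.Gamma ((d : ℂ) / 2 + Complex.I * ((l : ℂ) / 2))‖ ^ 2 : ℝ) : ℂ) = 0) ∧
    (∀ n : ℕ,
      0 < ∫ l : ℝ, ‖WeylRadial.g (1 / 2) d n (l : ℂ)‖ ^ 2 *
        ‖Complex.Gamma ((d : ℂ) / 2 + Complex.I * ((l : ℂ) / 2))‖ ^ 2) := by
  exact ⟨fun k l => WeylRadial.g_half_eq_continuousHahn hd k l,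
    fun k l => WeylRadial.g_half_eq_meixnerPollaczek hd k l,
    fun m n => WeylRadial.integrable_g_half hd m n,
    fun _ _ hmn => WeylRadial.integral_g_half_eq_zero hd hmn,
    fun n => WeylRadial.integral_norm_g_half_pos hd n⟩
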